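/- For $X\in M_n(\mathbb C)$ let $|X|=(X^*X)^{1/2}$, and let $\lambda_1(X),\dots,\lambda_n(X)$ be the eigenvalues of $X$, counted with algebraic multiplicity and ordered so that $|\lambda_1(X)|\ge\cdots\ge|\lambda_n(X)|$. The hyperbolic component of $A\in M_n(\mathbb C)$ is the matrix $H$ that acts as multiplication by $|\mu|$ on the generalized eigenspace of $A$ for each eigenvalue $\mu$; that is, $H=M_0\big(\bigoplus_i|\mu_i|I_{n_i}\big)M_0^{-1}$ whenever $A=M_0\big(\bigoplus_i J_A(\mu_i)\big)M_0^{-1}$ is a Jordan canonical form of $A$ ($\mu_i$ the distinct eigenvalues, $n_i$ their algebraic multiplicities). Put $D=\operatorname{diag}(|\lambda_1(A)|,\dots,|\lambda_n(A)|)$. (a) Let $A\in M_n(\mathbb C)$. There is $M\in GL_n(\mathbb C)$ with $H=MDM^{-1}$, and for all $M,C\in GL_n(\mathbb C)$ there are a lower triangular $L$ and a unitary $Q$ with $M^{-1}C=LQ$. For all $B,C,M\in GL_n(\mathbb C)$ with $H=MDM^{-1}$, and all lower triangular $L$ and unitary $Q$ with $M^{-1}C=LQ$, $$\lim_{m\to\infty}|BA^mC|^{1/m}=Q^*DQ,$$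 and this limit depends only on $A$ and $C$; it does not depend on $B$ or on the choice of $M$, $L$ and $Q$. (b) Let $A\in M_n(\mathbb R)$. Then the same statement holds over $\mathbb R$: there is $M\in GL_n(\mathbb R)$ with $H=MDM^{-1}$, and for all $M,C\in GL_n(\mathbb R)$ there are a real lower triangular $L$ and a real orthogonal $Q$ with $M^{-1}C=LQ$. For all $B,C,M\in GL_n(\mathbb R)$ with $H=MDM^{-1}$ and all such $L$ and $Q$, $\lim_{m\to\infty}|BA^mC|^{1/m}=Q^{T}DQ$ in $M_n(\mathbb R)$, and this limit depends only on $A$ and $C$. (c) (Nayak's theorem, the case $B=C=I$.) Let $A\in M_n(\mathbb C)$, let $\gamma_1>\cdots>\gamma_s\ge0$ be the distinct moduli of the eigenvalues of $A$, and let $A=S+N$ with $S$ diagonalizable, $N$ nilpotent and $SN=NS$. For $1\le j\le s$ let $E_j$ be the orthogonal projection onto the span of the eigenvectors of $S$ for eigenvalues of modulus at most $\gamma_j$, and let $E_{s+1}=0$. Then: (i) $|A^m|^{1/m}$ converges to the positive semidefinite matrix $\sum_{j=1}^s\gamma_j(E_j-E_{j+1})$ as $m\to\infty$. (ii) For $1\le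 j\le s$, a nonzero $x\in\mathbb C^n$ lies in $\operatorname{Im}E_j\setminus\operatorname{Im}E_{j+1}$ if and only if $\lim_{m\to\infty}\|A^mx\|^{1/m}=\gamma_j$, where $\|\cdot\|$ is the Euclidean norm. (iii) For $1\le j\le s$ and every $k\in\mathbb N$, $A^k$ maps $\operatorname{Im}E_j$ into itself and, if $\gamma_j>0$, also maps $\operatorname{Im}E_j\setminus\operatorname{Im}E_{j+1}$ into itself. -/

import Mathlib

open Filter Topology
open scoped MatrixOrder ComplexOrder

noncomputable section

namespace MatrixPowers

variable {n : ℕ}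

/-! ### Eigenvalue moduli -/

theorem length_sort_moduli (A : Matrix (Fin n) (Fin n) ℂ) :
    ((A.charpoly.roots.map (fun z => ‖z‖)).sort (· ≥ ·)).length = n := by
  have h := IsAlgClosed.card_roots_eq_natDegree (p := A.charpoly)
  rw [Multiset.length_sort, Multiset.card_map, h, Matrix.charpoly_natDegree_eq_dim,
    Fintype.card_fin]

/-- The moduli `|λ₁(A)| ≥ ⋯ ≥ |λₙ(A)|` of the eigenvalues of `A`, counted with algebraic
multiplicity and sorted in non-increasing order. -/
def eigenvalueModuli (A : Matrix (Fin n) (Fin n) ℂ) (i : Fin n) : ℝ :=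
  ((A.charpoly.roots.map (fun z => ‖z‖)).sort (· ≥ ·)).get
    (i.cast (length_sort_moduli A).symm)

theorem eigenvalueModuli_antitone (A : Matrix (Fin n) (Fin n) ℂ) :
    Antitone (eigenvalueModuli A) := by
  intro i j hij
  have h := (Multiset.pairwise_sort (A.charpoly.roots.map (fun z => ‖z‖)) (· ≥ ·)).sortedGE
  exact h.antitone_get (by simpa using hij)

theorem map_eigenvalueModuli (A : Matrix (Fin n) (Fin n) ℂ) :
    (Finset.univ.val.map (eigenvalueModuli A)) = A.charpoly.roots.map (fun z => ‖z‖) := by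
  have h1 : List.ofFn (eigenvalueModuli A) =
      (A.charpoly.roots.map (fun z => ‖z‖)).sort (· ≥ ·) := by
    apply List.ext_get
    · rw [List.length_ofFn, length_sort_moduli]
    · intro k h1 h2
      simp [eigenvalueModuli]
  rw [Fin.univ_val_map, h1, Multiset.sort_eq]

/-- The real matrix `D = diag(|λ₁(A)|, …, |λₙ(A)|)`. -/
def moduliMatrix (A : Matrix (Fin n) (Fin n) ℂ) : Matrix (Fin n) (Fin n) ℝ :=
  Matrix.diagonal (eigenvalueModuli A)

/-- A real matrix regarded as a complex one. -/
def toComplex (A : Matrix (Fin n) (Fin n) ℝ) : Matrix (Fin n) (Fin n) ℂ :=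
  A.map (fun x : ℝ => (x : ℂ))

/-- `|X|^{1/m}`, where `|X| = (X* X)^{1/2}`. -/
def absRoot {𝕜 : Type*} [RCLike 𝕜] (X : Matrix (Fin n) (Fin n) 𝕜) (m : ℕ) :
    Matrix (Fin n) (Fin n) 𝕜 :=
  CFC.abs X ^ (1 / (m : ℝ))

/-! ### The hyperbolic component -/

/-- The generalized eigenspace of `A` for the number `μ`. -/
def genEigenspace (A : Matrix (Fin n) (Fin n) ℂ) (μ : ℂ) : Submodule ℂ (Fin n → ℂ) :=
  Module.End.maxGenEigenspace (Matrix.toLin' A) μ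

theorem isCompl_genEigenspace (A : Matrix (Fin n) (Fin n) ℂ) (μ : ℂ) :
    IsCompl (genEigenspace A μ) (⨆ ν, ⨆ (_ : ν ≠ μ), genEigenspace A ν) := by
  refine ⟨Module.End.independent_maxGenEigenspace (Matrix.toLin' A) μ, ?_⟩
  rw [codisjoint_iff, eq_top_iff,
    ← Module.End.iSup_maxGenEigenspace_eq_top (Matrix.toLin' A)]
  refine iSup_le fun ν => ?_
  by_cases h : ν = μ
  · subst h
    exact le_sup_left
  · exact (le_iSup₂_of_le (f := fun κ (_ : κ ≠ μ) => genEigenspace A κ) ν h le_rfl).trans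
      le_sup_right

/-- The hyperbolic component `H` of `A`: the sum, over the distinct eigenvalues `μ` of `A`, of
`|μ|` times the projection onto the generalized eigenspace of `μ` along the sum of the other
generalized eigenspaces. Equivalently `H = M (⨁ |μᵢ| I) M⁻¹` for a matrix `M` that brings `A` to
Jordan canonical form, see `hyperbolicComponent_eq_of_jordan`. -/
def hyperbolicComponent (A : Matrix (Fin n) (Fin n) ℂ) : Matrix (Fin n) (Fin n) ℂ :=
  LinearMap.toMatrix' (∑ μ ∈ A.charpoly.roots.toFinset,
    ((‖μ‖ : ℝ) : ℂ) • Submodule.projection _ _ (isCompl_genEigenspace A μ))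

/-- `J` is a Jordan matrix: it vanishes off the diagonal and the superdiagonal, the superdiagonal
entries are `0` or `1`, and a `1` only joins two equal diagonal entries. -/
def IsJordanMatrix (J : Matrix (Fin n) (Fin n) ℂ) : Prop :=
  ∀ i j : Fin n, i ≠ j →
    J i j = 0 ∨ ((j : ℕ) = (i : ℕ) + 1 ∧ J i j = 1 ∧ J i i = J j j)

theorem hyperbolicComponent_mulVec (A : Matrix (Fin n) (Fin n) ℂ) (μ : ℂ) (v : Fin n → ℂ)
    (hv : v ∈ genEigenspace A μ) :
    (hyperbolicComponent A).mulVec v = ((‖μ‖ : ℝ) : ℂ) • v := by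
  by_cases hv0 : v = 0
  · subst hv0; simp
  have hμ : μ ∈ A.charpoly.roots.toFinset := by
    have h1 : Module.End.HasEigenvalue (Matrix.toLin' A) μ := by
      have h2 : Module.End.HasUnifEigenvalue (Matrix.toLin' A) μ ⊤ := by
        intro h0
        apply hv0
        have h3 : v ∈ Module.End.genEigenspace (Matrix.toLin' A) μ ⊤ := hv
        rw [h0] at h3
        simpa using h3
      exact h2.lt (by simp)
    have h4 : μ ∈ spectrum ℂ A := by
      rw [← Matrix.spectrum_toLin']
      exact h1.mem_spectrum
    rw [Multiset.mem_toFinset, Polynomial.mem_roots A.charpoly_monic.ne_zero]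
    exact Matrix.mem_spectrum_iff_isRoot_charpoly.1 h4
  rw [hyperbolicComponent, LinearMap.toMatrix'_mulVec, LinearMap.sum_apply,
    Finset.sum_eq_single μ]
  · rw [LinearMap.smul_apply, Submodule.projection_apply_of_mem_left _ hv]
  · intro ν _ hν
    have : v ∈ ⨆ κ, ⨆ (_ : κ ≠ ν), genEigenspace A κ :=
      (le_iSup₂_of_le (f := fun κ (_ : κ ≠ ν) => genEigenspace A κ) μ (Ne.symm hν) le_rfl) hv
    rw [LinearMap.smul_apply, (Submodule.projection_apply_eq_zero_iff _).2 this, smul_zero]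
  · exact fun h => absurd hμ h

theorem hyperbolicComponent_eq_of_jordan (A M J : Matrix (Fin n) (Fin n) ℂ) (hM : IsUnit M)
    (hJ : IsJordanMatrix J) (hA : A = M * J * M⁻¹) :
    hyperbolicComponent A = M * Matrix.diagonal (fun i => ((‖J i i‖ : ℝ) : ℂ)) * M⁻¹ := by
  have hdet : IsUnit M.det := (Matrix.isUnit_iff_isUnit_det M).1 hM
  have hAM : A * M = M * J := by
    rw [hA, Matrix.mul_assoc, Matrix.nonsing_inv_mul _ hdet, Matrix.mul_one]
  have hmem : ∀ (k : ℕ) (i : Fin n), (i : ℕ) = k → M.col i ∈ genEigenspace A (J i i) := by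
    intro k
    induction k using Nat.strong_induction_on with
    | _ k ih =>
    intro i hi
    have hcol : A.mulVec (M.col i) = ∑ j, J j i • M.col j := by
      ext r
      have := congrFun (congrFun hAM r) i
      simpa [Matrix.mul_apply, Matrix.mulVec, dotProduct, mul_comm] using this
    have hstep : (Matrix.toLin' A - algebraMap ℂ _ (J i i)) (M.col i)
        ∈ genEigenspace A (J i i) := by
      have : (Matrix.toLin' A - algebraMap ℂ _ (J i i)) (M.col i)
          = ∑ j ∈ Finset.univ.erase i, J j i • M.col j := by
        rw [LinearMap.sub_apply, Matrix.toLin'_apply, hcol,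
          ← Finset.add_sum_erase _ _ (Finset.mem_univ i)]
        simp
      rw [this]
      refine Submodule.sum_mem _ fun j hj => ?_
      rcases hJ j i (Finset.ne_of_mem_erase hj) with h | ⟨h1, -, h3⟩
      · rw [h, zero_smul]; exact Submodule.zero_mem _
      · refine Submodule.smul_mem _ _ ?_
        rw [← h3]
        exact ih j (by omega) j rfl
    rw [genEigenspace, Module.End.mem_maxGenEigenspace] at hstep ⊢
    obtain ⟨p, hp⟩ := hstep
    refine ⟨p + 1, ?_⟩
    rw [pow_succ, Module.End.mul_apply]
    exact hp
  have hHM : hyperbolicComponent A * M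
      = M * Matrix.diagonal (fun i => ((‖J i i‖ : ℝ) : ℂ)) := by
    ext r i
    have := congrFun (hyperbolicComponent_mulVec A _ _ (hmem i i rfl)) r
    rw [Matrix.mul_diagonal]
    simpa [Matrix.mul_apply, Matrix.mulVec, dotProduct, mul_comm] using this
  rw [← hHM, Matrix.mul_assoc, Matrix.mul_nonsing_inv _ hdet, Matrix.mul_one]

/-! ### Data of Nayak's theorem -/

/-- `S` is similar to a diagonal matrix. -/
def IsDiagonalizable (S : Matrix (Fin n) (Fin n) ℂ) : Prop :=
  ∃ P : Matrix (Fin n) (Fin n) ℂ, IsUnit P ∧ (P⁻¹ * S * P).IsDiag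

/-- The orthogonal projection onto the span of the eigenvectors of `S` that belong to eigenvalues
of modulus at most `t`. -/
def spectralProjection (S : Matrix (Fin n) (Fin n) ℂ) (t : ℝ) : Matrix (Fin n) (Fin n) ℂ :=
  (Matrix.toEuclideanCLM (𝕜 := ℂ) (n := Fin n)).symm
    (Submodule.span ℂ {x : EuclideanSpace ℂ (Fin n) |
      ∃ μ : ℂ, ‖μ‖ ≤ t ∧ Matrix.toEuclideanCLM (𝕜 := ℂ) S x = μ • x}).starProjection

/-- The projections `E₁, …, Eₛ` for the moduli `γ₁, …, γₛ`, followed by `Eₛ₊₁ = 0`; the indices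
are shifted down by one. -/
def nayakProjection {s : ℕ} (S : Matrix (Fin n) (Fin n) ℂ) (γ : Fin s → ℝ) (j : ℕ) :
    Matrix (Fin n) (Fin n) ℂ :=
  if h : j < s then spectralProjection S (γ ⟨j, h⟩) else 0

/-- The column space of `E`. -/
def imageOf (E : Matrix (Fin n) (Fin n) ℂ) : Set (EuclideanSpace ℂ (Fin n)) :=
  Set.range (Matrix.toEuclideanCLM (𝕜 := ℂ) E)

end MatrixPowers

end

/-!
Splitting `A` into a diagonalizable and a commuting nilpotent part gives `A ^ m = u m * H ^ m` for
large `m`, where `u m` and its inverse grow subexponentially: the unitary phases of the eigenvalues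
and the nilpotent perturbation make up a unit whose spectrum lies on the unit circle. As `D` has
nonincreasing entries and `L` is lower triangular, `D ^ m * L = K m * D ^ m` with `K m` and its
inverse bounded. Since `M⁻¹ * C = L * Q`, the matrix `B * A ^ m * C` is `v m * (Qᴴ * D * Q) ^ m`
with `v m` and its inverse subexponential, and such a factor disappears in the limit of
`|·| ^ (1 / m)` because taking roots is operator monotone. Over `ℝ`, the limit is inherited from the
complex one. A real `M` exists because `H` is real: if `X + i Y` intertwines `H` and `D`, then so
does `X + t Y` for every real `t`, and it is invertible for some `t`.

For Nayak's theorem, let the columns of `M` be eigenvectors of `S`. Invertible lower triangular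
matrices preserve the vectors supported on a given upper set of indices, so that in the orthonormal
basis given by `Q` the projections `Eⱼ` become coordinate projections, and the growth of `A ^ m x`
is decided by the largest entry of `D` on the support of `Q x`.
-/

open scoped Matrix

noncomputable section
namespace MatrixPowers

/-- `u` grows more slowly than every geometric sequence of ratio greater than `1`. -/
def SubexpGrowth {E : Type*} [Norm E] (u : ℕ → E) : Prop :=
  ∀ r : ℝ, 1 < r → ∀ᶠ m : ℕ in atTop, ‖u m‖ ≤ r ^ m

theorem SubexpGrowth.of_norm_le {E : Type*} [Norm E] {u : ℕ → E} (c : ℝ)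
    (hu : ∀ m, ‖u m‖ ≤ c) : SubexpGrowth u := by
  intro r hr
  filter_upwards [(tendsto_pow_atTop_atTop_of_one_lt hr).eventually_ge_atTop c] with m hm
  exact (hu m).trans hm

theorem SubexpGrowth.const {E : Type*} [Norm E] (a : E) : SubexpGrowth (fun _ : ℕ => a) :=
  .of_norm_le ‖a‖ fun _ => le_rfl

theorem SubexpGrowth.norm {E : Type*} [SeminormedAddCommGroup E] {u : ℕ → E}
    (hu : SubexpGrowth u) : SubexpGrowth (fun m => ‖u m‖) :=
  fun r hr => (hu r hr).mono fun m hm => (norm_norm (u m)).trans_le hm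

theorem SubexpGrowth.mul {E : Type*} [SeminormedRing E] {u v : ℕ → E} (hu : SubexpGrowth u)
    (hv : SubexpGrowth v) : SubexpGrowth (fun m => u m * v m) := by
  intro r hr
  have hsqrt : 1 < √r := Real.lt_sqrt_of_sq_lt (by simpa using hr)
  filter_upwards [hu _ hsqrt, hv _ hsqrt] with m hum hvm
  calc ‖u m * v m‖ ≤ ‖u m‖ * ‖v m‖ := norm_mul_le _ _
    _ ≤ √r ^ m * √r ^ m := mul_le_mul hum hvm (norm_nonneg _) (by positivity)
    _ = r ^ m := by rw [← mul_pow, Real.mul_self_sqrt (by linarith)]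

theorem subexpGrowth_pow_of_norm_spectrum_le_one {E : Type*} [NormedRing E] [NormedAlgebra ℂ E]
    [CompleteSpace E] {a : E} (ha : ∀ z ∈ spectrum ℂ a, ‖z‖ ≤ 1) :
    SubexpGrowth (fun m => a ^ m) := by
  intro r hr
  have hrad : spectralRadius ℂ a < ENNReal.ofReal r :=
    lt_of_le_of_lt (b := 1) (iSup₂_le fun z hz => by exact_mod_cast ha z hz) (by simpa using hr)
  filter_upwards [(spectrum.pow_norm_pow_one_div_tendsto_nhds_spectralRadius a).eventually_lt_const
    hrad, eventually_ne_atTop 0] with m hm hm0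
  calc ‖a ^ m‖ = (‖a ^ m‖ ^ (1 / m : ℝ)) ^ m := by
        rw [one_div, Real.rpow_inv_natCast_pow (norm_nonneg _) hm0]
    _ ≤ r ^ m := pow_le_pow_left₀ (by positivity)
        ((ENNReal.ofReal_lt_ofReal_iff (by linarith)).1 hm).le m

/-- The sequences of units that grow subexponentially together with their inverses. Up to a factor
from this group, sequences have the same exponential behaviour. -/
def subexpUnits (E : Type*) [SeminormedRing E] : Subgroup (ℕ → Eˣ) where
  carrier := {u | SubexpGrowth (fun m => (u m : E)) ∧ SubexpGrowth (fun m => (↑(u m)⁻¹ : E))}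
  one_mem' := by
    constructor <;> simpa using SubexpGrowth.const (1 : E)
  mul_mem' := by
    rintro u v ⟨hu, hu'⟩ ⟨hv, hv'⟩
    exact ⟨by simpa using hu.mul hv, by simpa using hv'.mul hu'⟩
  inv_mem' := by
    rintro u ⟨hu, hu'⟩
    exact ⟨hu', by simpa using hu⟩

theorem const_mem_subexpUnits {E : Type*} [SeminormedRing E] (a : Eˣ) :
    (fun _ => a) ∈ subexpUnits E :=
  ⟨.const _, .const _⟩

theorem pow_mem_subexpUnits {E : Type*} [NormedRing E] [NormedAlgebra ℂ E] [CompleteSpace E]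
    {a : Eˣ} (ha : ∀ z ∈ spectrum ℂ (a : E), ‖z‖ = 1) : (fun m => a ^ m) ∈ subexpUnits E := by
  have hinv : ∀ z ∈ spectrum ℂ (↑a⁻¹ : E), ‖z‖ = 1 := by
    intro z hz
    lift z to ℂˣ using (spectrum.ne_zero_of_mem_of_unit hz).isUnit
    simpa using ha _ ((spectrum.inv_mem_iff (r := z⁻¹)).2 (by simpa using hz))
  constructor
  · simpa using subexpGrowth_pow_of_norm_spectrum_le_one fun z hz => (ha z hz).le
  · simpa using subexpGrowth_pow_of_norm_spectrum_le_one fun z hz => (hinv z hz).le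

theorem tendsto_of_forall_one_lt_dist_le {X ι : Type*} [PseudoMetricSpace X] {l : Filter ι}
    {x : ι → X} {a : X} {c : ℝ}
    (h : ∀ r : ℝ, 1 < r → ∀ᶠ m in l, dist (x m) a ≤ (r - 1) * r * c) : Tendsto x l (𝓝 a) := by
  rw [Metric.tendsto_nhds]
  intro ε hε
  have hlim : Tendsto (fun r : ℝ => (r - 1) * r * c) (𝓝[>] 1) (𝓝 0) := by
    have hcont : ContinuousAt (fun r : ℝ => (r - 1) * r * c) 1 := by fun_prop
    simpa using hcont.tendsto.mono_left nhdsWithin_le_nhds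
  obtain ⟨r, hr, hr1⟩ := ((hlim.eventually_lt_const hε).and self_mem_nhdsWithin).exists
  exact (h r hr1).mono fun m hm => hm.trans_lt hr

theorem tendsto_rpow_one_div_of_le_mul {a u v : ℕ → ℝ} {r : ℝ} (ha : ∀ m, 0 ≤ a m) (hr : 0 ≤ r)
    (hu : SubexpGrowth u) (hv : SubexpGrowth v) (hle : ∀ᶠ m in atTop, a m ≤ u m * r ^ m)
    (hge : ∀ᶠ m in atTop, r ^ m ≤ v m * a m) :
    Tendsto (fun m : ℕ => a m ^ (1 / (m : ℝ))) atTop (𝓝 r) := by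
  refine tendsto_of_forall_one_lt_dist_le (c := r) fun t ht => ?_
  filter_upwards [hu t ht, hv t ht, hle, hge, eventually_ne_atTop 0] with m hum hvm hlem hgem hm
  have ht0 : 0 ≤ t := by linarith
  have hroot : (a m ^ (1 / (m : ℝ))) ^ m = a m := by
    rw [one_div, Real.rpow_inv_natCast_pow (ha m) hm]
  have hroot0 : 0 ≤ a m ^ (1 / (m : ℝ)) := Real.rpow_nonneg (ha m) _
  have hupper : a m ^ (1 / (m : ℝ)) ≤ t * r := by
    refine le_of_pow_le_pow_left₀ hm (mul_nonneg ht0 hr) ?_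
    rw [hroot, mul_pow]
    exact hlem.trans (by gcongr; exact (le_abs_self _).trans hum)
  have hlower : r ≤ t * a m ^ (1 / (m : ℝ)) := by
    refine le_of_pow_le_pow_left₀ hm (mul_nonneg ht0 hroot0) ?_
    rw [mul_pow, hroot]
    exact hgem.trans (by gcongr; exacts [ha m, (le_abs_self _).trans hvm])
  rw [Real.dist_eq, abs_le]
  have ht1 : 0 ≤ t - 1 := by linarith
  constructor <;> nlinarith [mul_le_mul_of_nonneg_left hupper ht1, mul_nonneg ht1 hr,
    mul_nonneg ht1 (mul_nonneg ht1 hr)]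

section ContinuousFunctionalCalculus

variable {R : Type*} [Ring R] [StarRing R] [TopologicalSpace R] [IsTopologicalRing R] [T2Space R]
  [PartialOrder R] [StarOrderedRing R] [Algebra ℝ R] [NonnegSpectrumClass ℝ R]
  [ContinuousFunctionalCalculus ℝ R IsSelfAdjoint]

theorem pow_rpow_inv_natCast {a : R} (ha : 0 ≤ a) {k : ℕ} (hk : k ≠ 0) :
    (a ^ k) ^ (k : ℝ)⁻¹ = a := by
  rw [← CFC.rpow_natCast a k ha,
    CFC.rpow_rpow_of_exponent_nonneg a _ _ (by positivity) (by positivity) ha,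
    mul_inv_cancel₀ (by exact_mod_cast hk), CFC.rpow_one a ha]

theorem eq_of_pow_eq_pow_of_nonneg {a b : R} (ha : 0 ≤ a) (hb : 0 ≤ b) {k : ℕ} (hk : k ≠ 0)
    (h : a ^ k = b ^ k) : a = b := by
  rw [← pow_rpow_inv_natCast ha hk, h, pow_rpow_inv_natCast hb hk]

theorem abs_rpow_one_div_pow (a : R) {m : ℕ} (hm : m ≠ 0) :
    (CFC.abs a ^ (1 / (m : ℝ))) ^ (2 * m) = star a * a := by
  rw [mul_comm, pow_mul, ← CFC.rpow_natCast (CFC.abs a ^ (1 / (m : ℝ))) m CFC.rpow_nonneg,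
    CFC.rpow_rpow_of_exponent_nonneg _ _ _ (by positivity) (by positivity) (CFC.abs_nonneg a),
    one_div_mul_cancel (by exact_mod_cast hm), CFC.rpow_one _ (CFC.abs_nonneg a), CFC.abs_sq]

end ContinuousFunctionalCalculus

section CStarAlgebra

variable {𝒜 : Type*} [CStarAlgebra 𝒜] [PartialOrder 𝒜] [StarOrderedRing 𝒜]

theorem le_of_pow_le_pow_of_nonneg {a b : 𝒜} (ha : 0 ≤ a) (hb : 0 ≤ b) {k : ℕ} (hk : k ≠ 0)
    (h : a ^ k ≤ b ^ k) : a ≤ b := by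
  have hk1 : (1 : ℝ) ≤ k := by exact_mod_cast Nat.one_le_iff_ne_zero.2 hk
  have hroot := CFC.rpow_le_rpow (p := (k : ℝ)⁻¹) ⟨by positivity, inv_le_one_of_one_le₀ hk1⟩ h
  rwa [pow_rpow_inv_natCast ha hk, pow_rpow_inv_natCast hb hk] at hroot

theorem star_mul_self_le_smul_of_norm_le {g : 𝒜} (y : 𝒜) {c : ℝ} (hg : ‖g‖ ≤ c) :
    star (g * y) * (g * y) ≤ c ^ 2 • (star y * y) := by
  have hgc : star g * g ≤ algebraMap ℝ 𝒜 (c ^ 2) :=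
    CStarAlgebra.star_mul_le_algebraMap_norm_sq.trans
      (algebraMap_mono 𝒜 (pow_le_pow_left₀ (norm_nonneg _) hg 2))
  simpa [mul_assoc, Algebra.algebraMap_eq_smul_one] using star_left_conjugate_le_conjugate hgc y

theorem abs_mul_pow_rpow_le {g d : 𝒜} {r : ℝ} {m : ℕ} (hm : m ≠ 0) (hr : 0 ≤ r) (hd : 0 ≤ d)
    (hg : ‖g‖ ≤ r ^ m) : CFC.abs (g * d ^ m) ^ (1 / (m : ℝ)) ≤ r • d := by
  refine le_of_pow_le_pow_of_nonneg CFC.rpow_nonneg (smul_nonneg hr hd)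
    (mul_ne_zero two_ne_zero hm) ?_
  calc (CFC.abs (g * d ^ m) ^ (1 / (m : ℝ))) ^ (2 * m)
      = star (g * d ^ m) * (g * d ^ m) := abs_rpow_one_div_pow _ hm
    _ ≤ (r ^ m) ^ 2 • (star (d ^ m) * d ^ m) := star_mul_self_le_smul_of_norm_le _ hg
    _ = (r • d) ^ (2 * m) := by
      rw [star_pow, (IsSelfAdjoint.of_nonneg hd).star_eq, smul_pow, ← pow_add, ← pow_mul, two_mul,
        mul_two]

theorem le_smul_abs_mul_pow_rpow {u : 𝒜ˣ} {d : 𝒜} {r : ℝ} {m : ℕ} (hm : m ≠ 0) (hr : 0 ≤ r)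
    (hd : 0 ≤ d) (hu : ‖(↑u⁻¹ : 𝒜)‖ ≤ r ^ m) :
    d ≤ r • CFC.abs (u * d ^ m) ^ (1 / (m : ℝ)) := by
  refine le_of_pow_le_pow_of_nonneg hd (smul_nonneg hr CFC.rpow_nonneg)
    (mul_ne_zero two_ne_zero hm) ?_
  calc d ^ (2 * m) = star (↑u⁻¹ * (u * d ^ m)) * (↑u⁻¹ * (u * d ^ m)) := by
        rw [Units.inv_mul_cancel_left, star_pow, (IsSelfAdjoint.of_nonneg hd).star_eq, ← pow_add,
          two_mul]
    _ ≤ (r ^ m) ^ 2 • (star (u * d ^ m) * (u * d ^ m)) := star_mul_self_le_smul_of_norm_le _ hu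
    _ = (r • CFC.abs (u * d ^ m) ^ (1 / (m : ℝ))) ^ (2 * m) := by
      rw [smul_pow, abs_rpow_one_div_pow _ hm, ← pow_mul, mul_comm]

theorem norm_sub_le_of_le_smul {x d : 𝒜} {r : ℝ} (hr : 1 ≤ r) (hd : 0 ≤ d) (hxd : x ≤ r • d)
    (hdx : d ≤ r • x) : ‖x - d‖ ≤ (r - 1) * r * (3 * ‖d‖) := by
  have hr1 : 0 ≤ r - 1 := by linarith
  have hrr : 0 ≤ (r - 1) * r := mul_nonneg hr1 (by linarith)
  have hlower : 0 ≤ x - d + ((r - 1) * r) • d :=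
    calc 0 ≤ (r • x - d) + (r - 1) • (r • d - x) :=
          add_nonneg (sub_nonneg.2 hdx) (smul_nonneg hr1 (sub_nonneg.2 hxd))
      _ = x - d + ((r - 1) * r) • d := by module
  have hupper : x - d + ((r - 1) * r) • d ≤ (2 * ((r - 1) * r)) • d := by
    refine sub_nonneg.1 ?_
    calc 0 ≤ (r • d - x) + ((r - 1) * (r - 1)) • d :=
          add_nonneg (sub_nonneg.2 hxd) (smul_nonneg (mul_nonneg hr1 hr1) hd)
      _ = (2 * ((r - 1) * r)) • d - (x - d + ((r - 1) * r) • d) := by module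
  calc ‖x - d‖ = ‖(x - d + ((r - 1) * r) • d) - ((r - 1) * r) • d‖ := by rw [add_sub_cancel_right]
    _ ≤ ‖x - d + ((r - 1) * r) • d‖ + ‖((r - 1) * r) • d‖ := norm_sub_le _ _
    _ ≤ ‖(2 * ((r - 1) * r)) • d‖ + ‖((r - 1) * r) • d‖ := by
      gcongr
      exact CStarAlgebra.norm_le_norm_of_nonneg_of_le hlower hupper
    _ = (r - 1) * r * (3 * ‖d‖) := by
      rw [norm_smul, norm_smul, Real.norm_of_nonneg hrr, Real.norm_of_nonneg (by positivity)]
      ring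

theorem tendsto_abs_mul_pow_rpow {u : ℕ → 𝒜ˣ} (hu : u ∈ subexpUnits 𝒜) {d : 𝒜} (hd : 0 ≤ d) :
    Tendsto (fun m : ℕ => CFC.abs (u m * d ^ m) ^ (1 / (m : ℝ))) atTop (𝓝 d) := by
  refine tendsto_of_forall_one_lt_dist_le (c := 3 * ‖d‖) fun r hr => ?_
  filter_upwards [hu.1 r hr, hu.2 r hr, eventually_ne_atTop 0] with m hum hum' hm
  rw [dist_eq_norm]
  exact norm_sub_le_of_le_smul hr.le hd (abs_mul_pow_rpow_le hm (by linarith) hd hum)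
    (le_smul_abs_mul_pow_rpow hm (by linarith) hd hum')

end CStarAlgebra

theorem isLowerTriangular_inv {ι K : Type*} [Fintype ι] [LinearOrder ι] [Field K]
    {L : Matrix ι ι K} (hL : L.IsLowerTriangular) (hu : IsUnit L) : L⁻¹.IsLowerTriangular := by
  have := hu.invertible
  exact Matrix.blockTriangular_inv_of_blockTriangular hL

section Scaling

variable {ι : Type*}

/-- The quotient `dᵢ / dⱼ`, or `1` if `dⱼ = 0`: this choice makes the ratios multiplicative along
chains `k ≤ j ≤ i` when `d` is antitone and nonnegative. -/
def scalingRatio (d : ι → ℝ) (i j : ι) : ℝ :=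
  if d j = 0 then 1 else d i / d j

theorem scalingRatio_self (d : ι → ℝ) (i : ι) : scalingRatio d i i = 1 := by
  unfold scalingRatio
  split_ifs with h
  exacts [rfl, div_self h]

/-- The matrix `K` with `Dᵐ L = K Dᵐ`, for `D = diag(d)` and `L` lower triangular. -/
def diagonalScaling {𝕜 : Type*} [RCLike 𝕜] (d : ι → ℝ) (L : Matrix ι ι 𝕜) (m : ℕ) : Matrix ι ι 𝕜 :=
  .of fun i j => L i j * (scalingRatio d i j : 𝕜) ^ m

theorem diagonalScaling_one {𝕜 : Type*} [RCLike 𝕜] [DecidableEq ι] (d : ι → ℝ) (m : ℕ) :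
    diagonalScaling d (1 : Matrix ι ι 𝕜) m = 1 := by
  ext i j
  rcases eq_or_ne i j with rfl | h
  · simp [diagonalScaling, scalingRatio_self]
  · simp [diagonalScaling, Matrix.one_apply_ne h]

variable [Preorder ι]

theorem scalingRatio_mul {d : ι → ℝ} (hd : Antitone d) (hd0 : 0 ≤ d) {i j k : ι}
    (hij : j ≤ i) (hjk : k ≤ j) :
    scalingRatio d i j * scalingRatio d j k = scalingRatio d i k := by
  have vanish {a b : ι} (hab : b ≤ a) (hb : d b = 0) : d a = 0 :=
    le_antisymm (hb ▸ hd hab) (hd0 a)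
  unfold scalingRatio
  by_cases hk : d k = 0
  · simp [hk, vanish hjk hk]
  · by_cases hj : d j = 0
    · simp [hk, hj, vanish hij hj]
    · rw [if_neg hk, if_neg hj, if_neg hk, div_mul_div_cancel₀ hj]

theorem abs_scalingRatio_le_one {d : ι → ℝ} (hd : Antitone d) (hd0 : 0 ≤ d) {i j : ι}
    (hij : j ≤ i) : |scalingRatio d i j| ≤ 1 := by
  unfold scalingRatio
  split_ifs with h
  · simp
  · rw [abs_of_nonneg (div_nonneg (hd0 i) (hd0 j))]
    exact div_le_one_of_le₀ (hd hij) (hd0 j)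

theorem pow_eq_scalingRatio_pow_mul_pow {d : ι → ℝ} (hd : Antitone d) (hd0 : 0 ≤ d) {i j : ι}
    (hij : j ≤ i) (m : ℕ) : d i ^ m = scalingRatio d i j ^ m * d j ^ m := by
  unfold scalingRatio
  split_ifs with hj
  · have hi : d i = 0 := le_antisymm (hj ▸ hd hij) (hd0 i)
    simp [hi, hj]
  · rw [← mul_pow, div_mul_cancel₀ _ hj]

end Scaling

section Triangular

variable {ι 𝕜 : Type*} [Fintype ι] [LinearOrder ι] [RCLike 𝕜]

theorem exists_lowerTriangular_mul_unitary [LocallyFiniteOrderBot ι] (Y : Matrix ι ι 𝕜) :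
    ∃ L Q : Matrix ι ι 𝕜,
      L.IsLowerTriangular ∧ Q ∈ Matrix.unitaryGroup ι 𝕜 ∧ Y = L * Q := by
  let rows : ι → EuclideanSpace 𝕜 ι := fun i => WithLp.toLp 2 (Y i)
  let b := InnerProductSpace.gramSchmidtOrthonormalBasis (𝕜 := 𝕜) (by simp) rows
  refine ⟨.of fun i j => inner 𝕜 (b j) (rows i), .of fun j => b j, ?_, ?_, ?_⟩
  · intro i j hij
    exact InnerProductSpace.gramSchmidtOrthonormalBasis_inv_triangular _ rows (by simpa using hij)
  · rw [Matrix.mem_unitaryGroup_iff]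
    ext i j
    simpa [Matrix.mul_apply, Matrix.one_apply, PiLp.inner_apply, eq_comm] using
      orthonormal_iff_ite.1 b.orthonormal j i
  · ext i k
    have hrow := congrArg (fun x => x k) (b.sum_repr' (rows i))
    simpa [Matrix.mul_apply, rows] using hrow.symm

theorem diagonalScaling_mul {d : ι → ℝ} (hd : Antitone d) (hd0 : 0 ≤ d)
    {L L' : Matrix ι ι 𝕜} (hL : L.IsLowerTriangular) (hL' : L'.IsLowerTriangular) (m : ℕ) :
    diagonalScaling d L m * diagonalScaling d L' m = diagonalScaling d (L * L') m := by
  ext i k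
  simp only [diagonalScaling, Matrix.mul_apply, Matrix.of_apply, Finset.sum_mul]
  refine Finset.sum_congr rfl fun j _ => ?_
  by_cases hij : j ≤ i
  · by_cases hjk : k ≤ j
    · rw [← scalingRatio_mul hd hd0 hij hjk]
      push_cast
      ring
    · rw [hL' (i := j) (j := k) (by simpa using hjk)]
      ring
  · rw [hL (i := i) (j := j) (by simpa using hij)]
    ring

theorem diagonal_pow_mul_eq {d : ι → ℝ} (hd : Antitone d) (hd0 : 0 ≤ d) {L : Matrix ι ι 𝕜}
    (hL : L.IsLowerTriangular) (m : ℕ) :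
    Matrix.diagonal (fun i => (d i : 𝕜)) ^ m * L =
      diagonalScaling d L m * Matrix.diagonal (fun i => (d i : 𝕜)) ^ m := by
  ext i j
  rw [Matrix.diagonal_pow, Matrix.diagonal_mul, Matrix.mul_diagonal]
  simp only [diagonalScaling, Matrix.of_apply, Pi.pow_apply]
  by_cases hij : j ≤ i
  · rw [← RCLike.ofReal_pow, pow_eq_scalingRatio_pow_mul_pow hd hd0 hij m]
    push_cast
    ring
  · rw [hL (i := i) (j := j) (by simpa using hij)]
    ring

open scoped Matrix.Norms.L2Operator

theorem subexpGrowth_diagonalScaling {d : ι → ℝ} (hd : Antitone d) (hd0 : 0 ≤ d)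
    {L : Matrix ι ι 𝕜} (hL : L.IsLowerTriangular) : SubexpGrowth (diagonalScaling d L) := by
  refine .of_norm_le (∑ i, ∑ j, ‖L i j‖ * ‖Matrix.single i j (1 : 𝕜)‖) fun m => ?_
  have hentry (i j : ι) : ‖diagonalScaling d L m i j‖ ≤ ‖L i j‖ := by
    by_cases hij : j ≤ i
    · rw [diagonalScaling, Matrix.of_apply, norm_mul, norm_pow, RCLike.norm_ofReal]
      exact mul_le_of_le_one_right (norm_nonneg _)
        (pow_le_one₀ (abs_nonneg _) (abs_scalingRatio_le_one hd hd0 hij))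
    · simp [diagonalScaling, hL (i := i) (j := j) (by simpa using hij)]
  calc ‖diagonalScaling d L m‖
      = ‖∑ i, ∑ j, diagonalScaling d L m i j • Matrix.single i j (1 : 𝕜)‖ := by
        simp only [Matrix.smul_single, smul_eq_mul, mul_one, ← Matrix.matrix_eq_sum_single]
    _ ≤ ∑ i, ∑ j, ‖L i j‖ * ‖Matrix.single i j (1 : 𝕜)‖ := by
        refine norm_sum_le_of_le _ fun i _ => norm_sum_le_of_le _ fun j _ => ?_
        rw [norm_smul]
        gcongr
        exact hentry i j

theorem exists_subexpUnits_diagonal_pow_mul_eq {d : ι → ℝ} (hd : Antitone d) (hd0 : 0 ≤ d)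
    {L : Matrix ι ι 𝕜} (hL : L.IsLowerTriangular) (hu : IsUnit L) :
    ∃ k ∈ subexpUnits (Matrix ι ι 𝕜), ∀ m,
      Matrix.diagonal (fun i => (d i : 𝕜)) ^ m * L =
        k m * Matrix.diagonal (fun i => (d i : 𝕜)) ^ m := by
  have hdet := (Matrix.isUnit_iff_isUnit_det L).1 hu
  have hL' := isLowerTriangular_inv hL hu
  refine ⟨fun m => ⟨diagonalScaling d L m, diagonalScaling d L⁻¹ m, ?_, ?_⟩,
    ⟨subexpGrowth_diagonalScaling hd hd0 hL, subexpGrowth_diagonalScaling hd hd0 hL'⟩,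
    diagonal_pow_mul_eq hd hd0 hL⟩
  · rw [diagonalScaling_mul hd hd0 hL hL', Matrix.mul_nonsing_inv _ hdet, diagonalScaling_one]
  · rw [diagonalScaling_mul hd hd0 hL' hL, Matrix.nonsing_inv_mul _ hdet, diagonalScaling_one]

end Triangular

theorem exists_basis_mem_maxGenEigenspace {ι K V : Type*} [Fintype ι] [Field K] [IsAlgClosed K]
    [AddCommGroup V] [Module K V] [FiniteDimensional K V] (f : Module.End K V) {μ : ι → K}
    (hμ : Finset.univ.val.map μ = f.charpoly.roots) :
    ∃ b : Module.Basis ι K V, ∀ i, b i ∈ f.maxGenEigenspace (μ i) := by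
  classical
  have hinternal : DirectSum.IsInternal f.maxGenEigenspace :=
    DirectSum.isInternal_submodule_of_iSupIndep_of_iSup_eq_top
      (Module.End.independent_maxGenEigenspace f) (Module.End.iSup_maxGenEigenspace_eq_top f)
  have hcard (ν : K) :
      Module.finrank K (f.maxGenEigenspace ν) = Fintype.card {i // μ i = ν} := by
    rw [LinearMap.finrank_maxGenEigenspace_eq, ← Polynomial.count_roots, ← hμ,
      Multiset.count_map, Fintype.card_subtype]
    simp only [eq_comm, Finset.card_def, Finset.filter_val]
  let fiberBasis (ν : K) : Module.Basis {i // μ i = ν} K (f.maxGenEigenspace ν) :=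
    (Module.finBasis K _).reindex (Fintype.equivFinOfCardEq (hcard ν).symm).symm
  refine ⟨(hinternal.collectedBasis fiberBasis).reindex (Equiv.sigmaFiberEquiv μ), fun i => ?_⟩
  rw [Module.Basis.reindex_apply]
  exact hinternal.collectedBasis_mem fiberBasis ((Equiv.sigmaFiberEquiv μ).symm i)

section JordanChevalley

variable {ι K : Type*} [Fintype ι] [DecidableEq ι] [Field K]

/-- The algebra of matrices that are diagonal in the basis formed by the columns of `M`:
`d ↦ M diag(d) M⁻¹`. -/
def conjDiagonal (M : (Matrix ι ι K)ˣ) : (ι → K) →ₐ[K] Matrix ι ι K :=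
  (MulSemiringAction.toAlgHom K (Matrix ι ι K) (ConjAct.toConjAct M)).comp
    (Matrix.diagonalAlgHom K)

theorem conjDiagonal_apply (M : (Matrix ι ι K)ˣ) (d : ι → K) :
    conjDiagonal M d = M * Matrix.diagonal d * (M : Matrix ι ι K)⁻¹ := by
  simp [conjDiagonal, ConjAct.units_smul_def, Matrix.coe_units_inv]

theorem exists_eq_conjDiagonal_add_nilpotent [IsAlgClosed K] (A : Matrix ι ι K) {μ : ι → K}
    (hμ : Finset.univ.val.map μ = A.charpoly.roots) :
    ∃ (M : (Matrix ι ι K)ˣ) (N : Matrix ι ι K), IsNilpotent N ∧ Commute (conjDiagonal M μ) N ∧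
      A = conjDiagonal M μ + N := by
  let f := Matrix.toLin' A
  obtain ⟨b, hb⟩ := exists_basis_mem_maxGenEigenspace f (μ := μ) (by simpa [f] using hμ)
  obtain ⟨n, -, s, hs_mem, hn, hs, hf⟩ := Module.End.exists_isNilpotent_isSemisimple (f := f)
  have hcomm : Commute f s := Algebra.commute_of_mem_adjoin_self hs_mem
  have hsb (i : ι) : s (b i) = μ i • b i :=
    Module.End.apply_eq_of_mem_of_comm_of_isFinitelySemisimple_of_isNil (hb i) hcomm
      hs.isFinitelySemisimple (by simpa [hf] using hn)
  have hdiag : LinearMap.toMatrix b b s = Matrix.diagonal μ := by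
    ext i j
    rw [LinearMap.toMatrix_apply, hsb, map_smul, Module.Basis.repr_self]
    rcases eq_or_ne i j with rfl | hij
    · simp
    · simp [hij]
  let e := Pi.basisFun K ι
  let M : (Matrix ι ι K)ˣ := ⟨e.toMatrix b, b.toMatrix e,
    Module.Basis.toMatrix_mul_toMatrix_flip _ _, Module.Basis.toMatrix_mul_toMatrix_flip _ _⟩
  have hS : LinearMap.toMatrixAlgEquiv' s = conjDiagonal M μ := by
    rw [conjDiagonal_apply, ← hdiag, ← Matrix.coe_units_inv]
    exact (basis_toMatrix_mul_linearMap_toMatrix_mul_basis_toMatrix e b e b s).symm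
  refine ⟨M, LinearMap.toMatrixAlgEquiv' n, hn.map LinearMap.toMatrixAlgEquiv', ?_, ?_⟩
  · rw [← hS, eq_sub_of_add_eq hf.symm]
    exact (hcomm.symm.sub_right (.refl s)).map LinearMap.toMatrixAlgEquiv'
  · rw [← hS, ← map_add, add_comm s, ← hf]
    exact (LinearMap.toMatrix'_toLin' A).symm

end JordanChevalley

section PowerGrowth

theorem spectrum_add_subset_of_isNilpotent {K R : Type*} [Field K] [Ring R] [Algebra K R]
    {s n : R} (hsn : Commute s n) (hn : IsNilpotent n) : spectrum K (s + n) ⊆ spectrum K s := by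
  intro z hz hunit
  refine hz ?_
  rw [spectrum.mem_resolventSet_iff, sub_add_eq_sub_sub, sub_eq_add_neg]
  exact hn.neg.isUnit_add_left_of_commute hunit
    ((Algebra.commute_algebraMap_right z n).sub_right hsn.symm).neg_left

theorem eventually_add_pow_eq_pow {R : Type*} [Semiring R] {x n : R} (hxn : x * n = 0)
    (hnx : n * x = 0) (hn : IsNilpotent n) : ∀ᶠ m in atTop, (x + n) ^ m = x ^ m := by
  have hpow (m : ℕ) : (x + n) ^ (m + 1) = x ^ (m + 1) + n ^ (m + 1) := by
    induction m with
    | zero => simp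
    | succ m ih =>
      rw [pow_succ, ih, add_mul, mul_add, mul_add, pow_succ x m, pow_succ n m, mul_assoc _ x n, hxn,
        mul_assoc _ n x, hnx]
      simp [pow_succ]
  obtain ⟨k, hk⟩ := hn
  filter_upwards [eventually_gt_atTop k] with m hm
  obtain ⟨m, rfl⟩ := Nat.exists_eq_succ_of_ne_zero (Nat.ne_zero_of_lt hm)
  rw [Nat.succ_eq_add_one, hpow, pow_eq_zero_of_le hm.le hk, add_zero]

theorem commute_apply_comp {ι K R : Type*} [Finite ι] [Field K] [Ring R] [Algebra K R]
    (Φ : (ι → K) →ₐ[K] R) {μ : ι → K} {x : R} (h : Commute (Φ μ) x) (g : K → K) :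
    Commute (Φ (g ∘ μ)) x := by
  classical
  -- `g` agrees with a polynomial on the finitely many values of `μ`
  let p := Lagrange.interpolate (Set.finite_range μ).toFinset id g
  have hp : g ∘ μ = Polynomial.aeval μ p := by
    ext i
    have := Lagrange.eval_interpolate_at_node (s := (Set.finite_range μ).toFinset) (v := id) g
      Function.injective_id.injOn (i := μ i) (by simp)
    rw [Polynomial.aeval_pi_apply₂, Polynomial.coe_aeval_eq_eval]
    exact this.symm
  rw [hp, ← Polynomial.aeval_algHom_apply]
  exact (Algebra.commute_of_mem_adjoin_singleton_of_commute
    (Polynomial.aeval_mem_adjoin_singleton K _) h.symm).symm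

theorem norm_eq_one_of_mem_spectrum_apply_add {ι R : Type*} [Finite ι] [Ring R] [Algebra ℂ R]
    (Φ : (ι → ℂ) →ₐ[ℂ] R) {p : ι → ℂ} (hp : ∀ i, ‖p i‖ = 1) {n : R} (hpn : Commute (Φ p) n)
    (hn : IsNilpotent n) {z : ℂ} (hz : z ∈ spectrum ℂ (Φ p + n)) : ‖z‖ = 1 := by
  have hzp : z ∈ spectrum ℂ p :=
    AlgHom.spectrum_apply_subset Φ p (spectrum_add_subset_of_isNilpotent hpn hn hz)
  rw [Pi.spectrum_eq, Set.mem_iUnion] at hzp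
  obtain ⟨i, hi⟩ := hzp
  obtain rfl : p i = z := by
    simpa [spectrum.mem_iff, sub_eq_zero, eq_comm] using hi
  exact hp i

theorem exists_unit_mul_add_nilpotent {ι R : Type*} [Finite ι] [Ring R] [Algebra ℂ R]
    (Φ : (ι → ℂ) →ₐ[ℂ] R) {μ : ι → ℂ} {x : R} (hx : IsNilpotent x) (hμx : Commute (Φ μ) x) :
    ∃ (u : Rˣ) (d y : R), (d = Φ fun i => ((‖μ i‖ : ℝ) : ℂ)) ∧ Φ μ + x = u * d + y ∧
      (∀ z ∈ spectrum ℂ (u : R), ‖z‖ = 1) ∧ Commute (u : R) d ∧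
      IsNilpotent y ∧ d * y = 0 ∧ y * d = 0 := by
  choose phase hnorm hphase using Complex.exists_norm_mul_eq_self
  have hcomm (g : ℂ → ℂ) : Commute (Φ (g ∘ μ)) x := commute_apply_comp Φ hμx g
  have hΦ (g h : ℂ → ℂ) : Commute (Φ (g ∘ μ)) (Φ (h ∘ μ)) := (Commute.all _ _).map Φ
  set p := Φ (phase ∘ μ)
  -- the inverse of the modulus on the nonzero eigenvalues, and `0` at the eigenvalue `0`
  set q := Φ ((fun z : ℂ => (‖z‖ : ℂ)⁻¹) ∘ μ)
  set d := Φ ((fun z : ℂ => (‖z‖ : ℂ)) ∘ μ)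
  have hpd : p * d = Φ μ := by
    rw [← map_mul]
    exact congrArg Φ (funext fun i => hphase (μ i))
  have hdqd : d * q * d = d := by
    rw [← map_mul, ← map_mul]
    exact congrArg Φ (funext fun i => mul_inv_mul_cancel (‖μ i‖ : ℂ))
  have hqd : Commute q d := hΦ _ _
  have hdx : Commute d x := hcomm _
  have hspec : ∀ z ∈ spectrum ℂ (p + q * x), ‖z‖ = 1 := fun z =>
    norm_eq_one_of_mem_spectrum_apply_add Φ (fun i => hnorm (μ i)) ((hΦ _ _).mul_right (hcomm _))
      ((hcomm _).isNilpotent_mul_left hx)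
  have hunit : IsUnit (p + q * x) := by
    rw [← spectrum.zero_notMem_iff ℂ]
    exact fun h => by simpa using hspec 0 h
  have hrest : Commute (1 - q * d) x :=
    (Commute.one_left x).sub_left ((hcomm _).mul_left hdx)
  have hd_rest : d * (1 - q * d) = 0 := by rw [mul_sub, mul_one, ← mul_assoc, hdqd, sub_self]
  refine ⟨hunit.unit, d, (1 - q * d) * x, rfl, ?_, hspec,
    (hΦ _ _).add_left (hqd.mul_left hdx.symm), hrest.isNilpotent_mul_left hx, ?_, ?_⟩
  · rw [IsUnit.unit_spec, add_mul, sub_mul, one_mul, mul_assoc q x, ← hdx.eq, ← mul_assoc, hpd,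
      add_assoc, add_sub_cancel]
  · rw [← mul_assoc, hd_rest, zero_mul]
  · rw [hrest.eq, mul_assoc, ((Commute.one_left d).sub_left (hqd.mul_left (.refl d))).eq,
      hd_rest, mul_zero]

theorem exists_subexpUnits_pow_eq_mul_pow {ι E : Type*} [Finite ι] [NormedRing E]
    [NormedAlgebra ℂ E] [CompleteSpace E] (Φ : (ι → ℂ) →ₐ[ℂ] E) {μ : ι → ℂ} {x : E}
    (hx : IsNilpotent x) (hμx : Commute (Φ μ) x) :
    ∃ u ∈ subexpUnits E, ∀ᶠ m : ℕ in atTop,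
      (Φ μ + x) ^ m = u m * Φ (fun i => ((‖μ i‖ : ℝ) : ℂ)) ^ m := by
  obtain ⟨u, d, y, rfl, hdecomp, hspec, hud, hy, hdy, hyd⟩ := exists_unit_mul_add_nilpotent Φ hx hμx
  refine ⟨fun m => u ^ m, pow_mem_subexpUnits hspec, ?_⟩
  have hudy : u * Φ (fun i => ((‖μ i‖ : ℝ) : ℂ)) * y = 0 := by rw [mul_assoc, hdy, mul_zero]
  have hyud : y * (u * Φ (fun i => ((‖μ i‖ : ℝ) : ℂ))) = 0 := by
    rw [hud.eq, ← mul_assoc, hyd, zero_mul]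
  filter_upwards [eventually_add_pow_eq_pow hudy hyud hy] with m hm
  rw [hdecomp, hm, hud.mul_pow, Units.val_pow_eq_pow_val]

end PowerGrowth

section HyperbolicComponent

variable {n : ℕ}

theorem mem_maxGenEigenspace_add_of_isNilpotent {R V : Type*} [CommRing R] [AddCommGroup V]
    [Module R V] {s n : Module.End R V} (hsn : Commute s n) (hn : IsNilpotent n) {μ : R} {v : V}
    (hv : s v = μ • v) : v ∈ (s + n).maxGenEigenspace μ := by
  have hcomm : Commute (s - μ • 1) n := hsn.sub_left ((Commute.one_left n).smul_left μ)
  have hkill : (s - μ • 1) v = 0 := by simp [hv]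
  have hpow (k : ℕ) : ((s + n - μ • 1) ^ k) v = (n ^ k) v := by
    induction k with
    | zero => simp
    | succ k ih =>
      have hshift : (s - μ • 1) ((n ^ k) v) = 0 := by
        rw [← Module.End.mul_apply, (hcomm.pow_right k).eq, Module.End.mul_apply, hkill, map_zero]
      rw [pow_succ', Module.End.mul_apply, ih, add_sub_right_comm, LinearMap.add_apply, hshift,
        zero_add, ← Module.End.mul_apply, ← pow_succ']
  obtain ⟨k, hk⟩ := hn
  exact (Module.End.mem_maxGenEigenspace _ _ _).2 ⟨k, by rw [hpow, hk, LinearMap.zero_apply]⟩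

theorem conjDiagonal_mulVec_col {ι K : Type*} [Fintype ι] [DecidableEq ι] [Field K]
    (M : (Matrix ι ι K)ˣ) (d : ι → K) (i : ι) :
    conjDiagonal M d *ᵥ (M : Matrix ι ι K).col i = d i • (M : Matrix ι ι K).col i := by
  rw [conjDiagonal_apply, ← Matrix.mulVec_single_one, Matrix.mulVec_mulVec, Matrix.mul_assoc,
    ← Matrix.coe_units_inv, Units.inv_mul, Matrix.mul_one, ← Matrix.mulVec_mulVec,
    Matrix.diagonal_mulVec_single, ← Matrix.mulVec_smul, ← Pi.single_smul, smul_eq_mul]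

theorem eq_conjDiagonal_of_mulVec_col {ι K : Type*} [Fintype ι] [DecidableEq ι] [Field K]
    {X : Matrix ι ι K} {M : (Matrix ι ι K)ˣ} {d : ι → K}
    (h : ∀ i, X *ᵥ (M : Matrix ι ι K).col i = d i • (M : Matrix ι ι K).col i) :
    X = conjDiagonal M d := by
  refine (Units.mul_left_inj M).1 (Matrix.ext_of_mulVec_single fun i => ?_)
  rw [← Matrix.mulVec_mulVec, ← Matrix.mulVec_mulVec, Matrix.mulVec_single_one, h,
    conjDiagonal_mulVec_col]

theorem exists_equiv_of_map_univ_eq {α β γ : Type*} [Fintype α] [Fintype β] (f : α → γ)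
    (g : β → γ) (h : Finset.univ.val.map f = Finset.univ.val.map g) :
    ∃ e : α ≃ β, ∀ a, g (e a) = f a := by
  classical
  have hcard (c : γ) : Fintype.card {a // f a = c} = Fintype.card {b // g b = c} := by
    have hcount := congrArg (Multiset.count c) h
    simp only [Multiset.count_map] at hcount
    rw [Fintype.card_subtype, Fintype.card_subtype]
    simpa [Finset.card, eq_comm] using hcount
  exact ⟨Equiv.ofFiberEquiv fun c => Fintype.equivOfCardEq (hcard c),
    fun a => Equiv.ofFiberEquiv_map _ a⟩

theorem exists_map_univ_eq_of_map_univ_eq_map {ι α β : Type*} [Fintype ι] {f : ι → β} {g : α → β}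
    {s : Multiset α} (h : Finset.univ.val.map f = s.map g) :
    ∃ μ : ι → α, Finset.univ.val.map μ = s ∧ ∀ i, g (μ i) = f i := by
  classical
  obtain ⟨e, he⟩ := exists_equiv_of_map_univ_eq f (fun x : s => g x)
    (by rw [h, Multiset.map_univ])
  refine ⟨fun i => e i, ?_, he⟩
  calc Finset.univ.val.map (fun i => (e i : α))
      = (Finset.univ.val.map e).map (fun x : s => (x : α)) := (Multiset.map_map _ _ _).symm
    _ = s := by rw [Multiset.map_univ_val_equiv, Multiset.map_univ_coe]

theorem hyperbolicComponent_conjDiagonal_add {M : (Matrix (Fin n) (Fin n) ℂ)ˣ} {μ : Fin n → ℂ}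
    {N : Matrix (Fin n) (Fin n) ℂ} (hN : IsNilpotent N) (hμN : Commute (conjDiagonal M μ) N) :
    hyperbolicComponent (conjDiagonal M μ + N) = conjDiagonal M (fun i => ((‖μ i‖ : ℝ) : ℂ)) := by
  refine eq_conjDiagonal_of_mulVec_col fun i => hyperbolicComponent_mulVec _ _ _ ?_
  rw [genEigenspace, map_add]
  exact mem_maxGenEigenspace_add_of_isNilpotent (hμN.map Matrix.toLinAlgEquiv')
    (hN.map Matrix.toLinAlgEquiv') (conjDiagonal_mulVec_col M μ i)

theorem toComplex_moduliMatrix (A : Matrix (Fin n) (Fin n) ℂ) :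
    toComplex (moduliMatrix A) = Matrix.diagonal (fun i => (eigenvalueModuli A i : ℂ)) := by
  rw [toComplex, moduliMatrix, Matrix.diagonal_map Complex.ofReal_zero]

theorem exists_jordanChevalley_eigenvalueModuli (A : Matrix (Fin n) (Fin n) ℂ) :
    ∃ (M : (Matrix (Fin n) (Fin n) ℂ)ˣ) (μ : Fin n → ℂ) (N : Matrix (Fin n) (Fin n) ℂ),
      (∀ i, ‖μ i‖ = eigenvalueModuli A i) ∧ IsNilpotent N ∧ Commute (conjDiagonal M μ) N ∧
        A = conjDiagonal M μ + N := by
  obtain ⟨μ, hroots, hμ⟩ := exists_map_univ_eq_of_map_univ_eq_map (map_eigenvalueModuli A)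
  obtain ⟨M, N, hN, hcomm, hA⟩ := exists_eq_conjDiagonal_add_nilpotent A hroots
  exact ⟨M, μ, N, hμ, hN, hcomm, hA⟩

theorem exists_hyperbolicComponent_eq (A : Matrix (Fin n) (Fin n) ℂ) :
    ∃ M : Matrix (Fin n) (Fin n) ℂ, IsUnit M ∧
      hyperbolicComponent A = M * toComplex (moduliMatrix A) * M⁻¹ := by
  obtain ⟨M, μ, N, hμ, hN, hcomm, hA⟩ := exists_jordanChevalley_eigenvalueModuli A
  refine ⟨M, M.isUnit, ?_⟩
  have hH := hyperbolicComponent_conjDiagonal_add hN hcomm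
  rw [← hA, conjDiagonal_apply] at hH
  simpa only [toComplex_moduliMatrix, hμ] using hH

open scoped Matrix.Norms.L2Operator in
theorem exists_subexpUnits_pow_eq_mul_hyperbolicComponent_pow (A : Matrix (Fin n) (Fin n) ℂ) :
    ∃ u ∈ subexpUnits (Matrix (Fin n) (Fin n) ℂ), ∀ᶠ m : ℕ in atTop,
      A ^ m = u m * hyperbolicComponent A ^ m := by
  obtain ⟨M, μ, N, -, hN, hcomm, rfl⟩ := exists_jordanChevalley_eigenvalueModuli A
  rw [hyperbolicComponent_conjDiagonal_add hN hcomm]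
  exact exists_subexpUnits_pow_eq_mul_pow _ hN hcomm

end HyperbolicComponent

section ComplexLimit

variable {n : ℕ}

theorem exists_mem_spectrum_norm_eq_eigenvalueModuli (A : Matrix (Fin n) (Fin n) ℂ) (i : Fin n) :
    ∃ z ∈ spectrum ℂ A, ‖z‖ = eigenvalueModuli A i := by
  have hmem : eigenvalueModuli A i ∈ A.charpoly.roots.map (fun z => ‖z‖) := by
    rw [← map_eigenvalueModuli]
    exact Multiset.mem_map_of_mem _ (Finset.mem_univ i)
  obtain ⟨z, hz, hzi⟩ := Multiset.mem_map.1 hmem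
  exact ⟨z, Matrix.mem_spectrum_iff_isRoot_charpoly.2 (Polynomial.isRoot_of_mem_roots hz), hzi⟩

theorem eigenvalueModuli_nonneg (A : Matrix (Fin n) (Fin n) ℂ) : 0 ≤ eigenvalueModuli A := by
  intro i
  obtain ⟨z, -, hz⟩ := exists_mem_spectrum_norm_eq_eigenvalueModuli A i
  exact hz ▸ norm_nonneg z

theorem toComplex_moduliMatrix_nonneg (A : Matrix (Fin n) (Fin n) ℂ) :
    0 ≤ toComplex (moduliMatrix A) := by
  rw [toComplex_moduliMatrix]
  exact (Matrix.PosSemidef.diagonal fun i => by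
    simpa using eigenvalueModuli_nonneg A i).nonneg

/-- The data `H = M D M⁻¹` and `M⁻¹ C = L Q` from which the limit of `|B Aᵐ C|^{1/m}` is read off,
where `H` is the hyperbolic component of `A` and `D` the diagonal matrix of its eigenvalue
moduli. -/
structure IsHyperbolicFactorization (A C M L Q : Matrix (Fin n) (Fin n) ℂ) : Prop where
  isUnit : IsUnit M
  hyperbolicComponent_eq : hyperbolicComponent A = M * toComplex (moduliMatrix A) * M⁻¹
  isLowerTriangular : L.IsLowerTriangular
  mem_unitaryGroup : Q ∈ Matrix.unitaryGroup (Fin n) ℂ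
  inv_mul_eq : M⁻¹ * C = L * Q

variable {A B C M L Q : Matrix (Fin n) (Fin n) ℂ}

theorem exists_isHyperbolicFactorization (A C : Matrix (Fin n) (Fin n) ℂ) :
    ∃ M L Q, IsHyperbolicFactorization A C M L Q := by
  obtain ⟨M, hM, hH⟩ := exists_hyperbolicComponent_eq A
  obtain ⟨L, Q, hL, hQ, hLQ⟩ := exists_lowerTriangular_mul_unitary (M⁻¹ * C)
  exact ⟨M, L, Q, hM, hH, hL, hQ, hLQ⟩

theorem IsHyperbolicFactorization.isUnit_lower (h : IsHyperbolicFactorization A C M L Q)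
    (hC : IsUnit C) : IsUnit L := by
  have hL : L = M⁻¹ * C * Qᴴ := by
    rw [h.inv_mul_eq, Matrix.mul_assoc, ← Matrix.star_eq_conjTranspose,
      Matrix.mem_unitaryGroup_iff.1 h.mem_unitaryGroup, Matrix.mul_one]
  rw [hL]
  exact ((Matrix.isUnit_nonsing_inv_iff.2 h.isUnit).mul hC).mul
    (IsUnit.of_mul_eq_one Q (Matrix.mem_unitaryGroup_iff'.1 h.mem_unitaryGroup))

theorem IsHyperbolicFactorization.hyperbolicComponent_pow_mul
    (h : IsHyperbolicFactorization A C M L Q) (m : ℕ) :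
    hyperbolicComponent A ^ m * C = M * (toComplex (moduliMatrix A) ^ m * L) * Q := by
  obtain ⟨M, rfl⟩ := h.isUnit
  rw [h.hyperbolicComponent_eq, ← Matrix.coe_units_inv, Units.conj_pow, Matrix.mul_assoc,
    Matrix.coe_units_inv, h.inv_mul_eq]
  simp only [Matrix.mul_assoc]

open scoped Matrix.Norms.L2Operator in
theorem IsHyperbolicFactorization.exists_subexpUnits_mul_pow_mul_eq
    (h : IsHyperbolicFactorization A C M L Q) (hB : IsUnit B) (hC : IsUnit C) :
    ∃ v ∈ subexpUnits (Matrix (Fin n) (Fin n) ℂ), ∀ᶠ m : ℕ in atTop,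
      B * A ^ m * C = v m * (toComplex (moduliMatrix A) ^ m * Q) := by
  obtain ⟨u, hu, hA⟩ := exists_subexpUnits_pow_eq_mul_hyperbolicComponent_pow A
  obtain ⟨k, hk, hD⟩ := exists_subexpUnits_diagonal_pow_mul_eq (eigenvalueModuli_antitone A)
    (eigenvalueModuli_nonneg A) h.isLowerTriangular (h.isUnit_lower hC)
  have hDL (m : ℕ) : toComplex (moduliMatrix A) ^ m * L = k m * toComplex (moduliMatrix A) ^ m := by
    rw [toComplex_moduliMatrix]
    exact hD m
  refine ⟨(fun _ => hB.unit) * u * (fun _ => h.isUnit.unit) * k,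
    mul_mem (mul_mem (mul_mem (const_mem_subexpUnits _) hu) (const_mem_subexpUnits _)) hk, ?_⟩
  filter_upwards [hA] with m hm
  calc B * A ^ m * C = B * u m * (hyperbolicComponent A ^ m * C) := by
        simp only [hm, Matrix.mul_assoc]
    _ = B * u m * (M * (k m * toComplex (moduliMatrix A) ^ m) * Q) := by
        rw [h.hyperbolicComponent_pow_mul, hDL]
    _ = (hB.unit * u m * h.isUnit.unit * k m : (Matrix (Fin n) (Fin n) ℂ)ˣ) *
          (toComplex (moduliMatrix A) ^ m * Q) := by
        simp [Matrix.mul_assoc]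

open scoped Matrix.Norms.L2Operator in
theorem IsHyperbolicFactorization.tendsto_absRoot (h : IsHyperbolicFactorization A C M L Q)
    (hB : IsUnit B) (hC : IsUnit C) :
    Tendsto (fun m : ℕ => absRoot (B * A ^ m * C) m) atTop
      (𝓝 (Qᴴ * toComplex (moduliMatrix A) * Q)) := by
  obtain ⟨v, hv, hA⟩ := h.exists_subexpUnits_mul_pow_mul_eq hB hC
  let q : (Matrix (Fin n) (Fin n) ℂ)ˣ := Unitary.toUnits ⟨Q, h.mem_unitaryGroup⟩
  have hlim := tendsto_abs_mul_pow_rpow (mul_mem hv (const_mem_subexpUnits q))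
    (star_left_conjugate_nonneg (toComplex_moduliMatrix_nonneg A) Q)
  refine hlim.congr' ?_
  filter_upwards [hA] with m hm
  have hconj : (star Q * toComplex (moduliMatrix A) * Q) ^ m =
      (↑q⁻¹ : Matrix (Fin n) (Fin n) ℂ) * toComplex (moduliMatrix A) ^ m * q :=
    Units.conj_pow' q _ m
  rw [absRoot, hm, hconj]
  simp only [Pi.mul_apply, Units.val_mul, Matrix.mul_assoc, Units.mul_inv_cancel_left]
  rfl

theorem IsHyperbolicFactorization.conj_eq {M' L' Q' : Matrix (Fin n) (Fin n) ℂ}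
    (h : IsHyperbolicFactorization A C M L Q) (h' : IsHyperbolicFactorization A C M' L' Q')
    (hC : IsUnit C) :
    Qᴴ * toComplex (moduliMatrix A) * Q = Q'ᴴ * toComplex (moduliMatrix A) * Q' :=
  tendsto_nhds_unique (h.tendsto_absRoot isUnit_one hC) (h'.tendsto_absRoot isUnit_one hC)

end ComplexLimit

section EntrywiseMap

variable {ι : Type*} [Fintype ι] [DecidableEq ι]

theorem mapMatrix_conjDiagonal {K L : Type*} [Field K] [Field L] (f : K →+* L)
    (M : (Matrix ι ι K)ˣ) (d : ι → K) :
    f.mapMatrix (conjDiagonal M d) =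
      conjDiagonal (Units.map (f.mapMatrix (m := ι) : Matrix ι ι K →* Matrix ι ι L) M) (f ∘ d) := by
  rw [conjDiagonal_apply, conjDiagonal_apply, ← Matrix.coe_units_inv, ← Matrix.coe_units_inv,
    map_mul, map_mul, ← map_inv]
  simp [Matrix.diagonal_map, Function.comp_def]

theorem exists_isUnit_add_smul {K R : Type*} [Field K] [Infinite K] [CommRing R] [Nontrivial R]
    [Algebra K R] {X Y : Matrix ι ι K} {z : R}
    (h : IsUnit (X.map (algebraMap K R) + z • Y.map (algebraMap K R))) :
    ∃ t : K, IsUnit (X + t • Y) := by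
  let p : Polynomial K :=
    (X.map Polynomial.C + (Polynomial.X : Polynomial K) • Y.map Polynomial.C).det
  have hpz : p.eval₂ (algebraMap K R) z =
      (X.map (algebraMap K R) + z • Y.map (algebraMap K R)).det := by
    rw [← Polynomial.coe_eval₂RingHom, RingHom.map_det]
    congr 1
    ext i j
    simp [mul_comm z]
  have hp : p ≠ 0 := by
    intro hp
    rw [hp, Polynomial.eval₂_zero] at hpz
    exact ((Matrix.isUnit_iff_isUnit_det _).1 h).ne_zero hpz.symm
  obtain ⟨t, ht⟩ : ∃ t : K, p.eval t ≠ 0 := by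
    by_contra! hzero
    exact hp (Polynomial.funext fun t => by simpa using hzero t)
  have hpt : p.eval t = (X + t • Y).det := by
    rw [← Polynomial.coe_evalRingHom, RingHom.map_det]
    congr 1
    ext i j
    simp [mul_comm t]
  exact ⟨t, (Matrix.isUnit_iff_isUnit_det _).2 (isUnit_iff_ne_zero.2 (hpt ▸ ht))⟩

end EntrywiseMap

section RealMatrices

variable {n : ℕ}

theorem toComplex_eq_mapMatrix (X : Matrix (Fin n) (Fin n) ℝ) :
    toComplex X = Complex.ofRealHom.mapMatrix X := rfl

theorem toComplex_mul (X Y : Matrix (Fin n) (Fin n) ℝ) :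
    toComplex (X * Y) = toComplex X * toComplex Y := by
  simp only [toComplex_eq_mapMatrix, map_mul]

theorem toComplex_one : toComplex (1 : Matrix (Fin n) (Fin n) ℝ) = 1 := by
  simp only [toComplex_eq_mapMatrix, map_one]

theorem toComplex_pow (X : Matrix (Fin n) (Fin n) ℝ) (k : ℕ) :
    toComplex (X ^ k) = toComplex X ^ k := by
  simp only [toComplex_eq_mapMatrix, map_pow]

theorem toComplex_transpose (X : Matrix (Fin n) (Fin n) ℝ) :
    toComplex Xᵀ = (toComplex X)ᴴ := by
  ext i j
  simp [toComplex]

theorem isUnit_toComplex {X : Matrix (Fin n) (Fin n) ℝ} (hX : IsUnit X) :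
    IsUnit (toComplex X) :=
  hX.map Complex.ofRealHom.mapMatrix

theorem toComplex_inv {X : Matrix (Fin n) (Fin n) ℝ} (hX : IsUnit X) :
    toComplex X⁻¹ = (toComplex X)⁻¹ := by
  refine (Matrix.inv_eq_right_inv ?_).symm
  rw [← toComplex_mul, Matrix.mul_nonsing_inv _ ((Matrix.isUnit_iff_isUnit_det _).1 hX),
    toComplex_one]

theorem isEmbedding_toComplex :
    IsEmbedding (toComplex : Matrix (Fin n) (Fin n) ℝ → Matrix (Fin n) (Fin n) ℂ) :=
  Function.LeftInverse.isEmbedding (f := fun Z => Z.map Complex.re)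
    (fun X => by ext i j; simp [toComplex]) (continuous_id.matrix_map Complex.continuous_re)
    (continuous_id.matrix_map Complex.continuous_ofReal)

theorem toComplex_nonneg {X : Matrix (Fin n) (Fin n) ℝ} (hX : 0 ≤ X) : 0 ≤ toComplex X := by
  obtain ⟨Y, rfl⟩ := CStarAlgebra.nonneg_iff_eq_star_mul_self.1 hX
  rw [Matrix.star_eq_conjTranspose, Matrix.conjTranspose_eq_transpose_of_trivial, toComplex_mul,
    toComplex_transpose]
  exact (Matrix.posSemidef_conjTranspose_mul_self _).nonneg

theorem absRoot_nonneg {𝕜 : Type*} [RCLike 𝕜] (X : Matrix (Fin n) (Fin n) 𝕜) (m : ℕ) :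
    0 ≤ absRoot X m :=
  CFC.rpow_nonneg

theorem absRoot_pow {𝕜 : Type*} [RCLike 𝕜] (X : Matrix (Fin n) (Fin n) 𝕜) {m : ℕ} (hm : m ≠ 0) :
    absRoot X m ^ (2 * m) = Xᴴ * X :=
  abs_rpow_one_div_pow X hm

theorem toComplex_absRoot (X : Matrix (Fin n) (Fin n) ℝ) {m : ℕ} (hm : m ≠ 0) :
    toComplex (absRoot X m) = absRoot (toComplex X) m := by
  refine eq_of_pow_eq_pow_of_nonneg (toComplex_nonneg (absRoot_nonneg X m)) (absRoot_nonneg _ m)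
    (mul_ne_zero two_ne_zero hm) ?_
  rw [← toComplex_pow, absRoot_pow _ hm, absRoot_pow _ hm, toComplex_mul,
    Matrix.conjTranspose_eq_transpose_of_trivial, toComplex_transpose]

theorem hyperbolicComponent_map_conj (A : Matrix (Fin n) (Fin n) ℂ) :
    hyperbolicComponent ((starRingEnd ℂ).mapMatrix A) =
      (starRingEnd ℂ).mapMatrix (hyperbolicComponent A) := by
  obtain ⟨M, μ, N, -, hN, hcomm, rfl⟩ := exists_jordanChevalley_eigenvalueModuli A
  have hcomm' := hcomm.map (starRingEnd ℂ).mapMatrix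
  rw [mapMatrix_conjDiagonal] at hcomm'
  rw [hyperbolicComponent_conjDiagonal_add hN hcomm, map_add, mapMatrix_conjDiagonal,
    mapMatrix_conjDiagonal, hyperbolicComponent_conjDiagonal_add (hN.map _) hcomm']
  congr 1
  ext i
  simp

theorem exists_toComplex_eq_of_map_conj_eq {X : Matrix (Fin n) (Fin n) ℂ}
    (hX : (starRingEnd ℂ).mapMatrix X = X) : ∃ Y, toComplex Y = X := by
  refine ⟨X.map Complex.re, ?_⟩
  ext i j
  exact Complex.conj_eq_iff_re.1 (congrFun₂ hX i j)

theorem exists_toComplex_eq_hyperbolicComponent (A : Matrix (Fin n) (Fin n) ℝ) :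
    ∃ H, toComplex H = hyperbolicComponent (toComplex A) := by
  have hA : (starRingEnd ℂ).mapMatrix (toComplex A) = toComplex A := by
    ext i j
    simp [toComplex]
  exact exists_toComplex_eq_of_map_conj_eq (by rw [← hyperbolicComponent_map_conj, hA])

theorem exists_real_intertwiner {H D : Matrix (Fin n) (Fin n) ℝ} {M : Matrix (Fin n) (Fin n) ℂ}
    (hM : IsUnit M) (h : toComplex H * M = M * toComplex D) :
    ∃ N : Matrix (Fin n) (Fin n) ℝ, IsUnit N ∧ H * N = N * D := by
  have hre : H * M.map Complex.re = M.map Complex.re * D := by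
    ext i j
    simpa [Matrix.mul_apply, toComplex] using congrArg Complex.re (congrFun₂ h i j)
  have him : H * M.map Complex.im = M.map Complex.im * D := by
    ext i j
    simpa [Matrix.mul_apply, toComplex] using congrArg Complex.im (congrFun₂ h i j)
  have hdecomp : (M.map Complex.re).map (algebraMap ℝ ℂ) +
      Complex.I • (M.map Complex.im).map (algebraMap ℝ ℂ) = M := by
    ext i j
    simp [mul_comm Complex.I]
  obtain ⟨t, ht⟩ := exists_isUnit_add_smul (hdecomp.symm ▸ hM)
  exact ⟨_, ht, by rw [Matrix.mul_add, Matrix.add_mul, Matrix.mul_smul, Matrix.smul_mul, hre, him]⟩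

theorem exists_real_hyperbolicComponent_eq (A : Matrix (Fin n) (Fin n) ℝ) :
    ∃ M : Matrix (Fin n) (Fin n) ℝ, IsUnit M ∧
      hyperbolicComponent (toComplex A) = toComplex (M * moduliMatrix (toComplex A) * M⁻¹) := by
  obtain ⟨M, hM, hMH⟩ := exists_hyperbolicComponent_eq (toComplex A)
  obtain ⟨H, hH⟩ := exists_toComplex_eq_hyperbolicComponent A
  have hintertwine : toComplex H * M = M * toComplex (moduliMatrix (toComplex A)) := by
    rw [hH, hMH, Matrix.mul_assoc,
      Matrix.nonsing_inv_mul _ ((Matrix.isUnit_iff_isUnit_det _).1 hM), Matrix.mul_one]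
  obtain ⟨N, hN, hHN⟩ := exists_real_intertwiner hM hintertwine
  refine ⟨N, hN, ?_⟩
  rw [← hH, ← hHN, Matrix.mul_assoc,
    Matrix.mul_nonsing_inv _ ((Matrix.isUnit_iff_isUnit_det _).1 hN), Matrix.mul_one]

theorem toComplex_mem_unitaryGroup {Q : Matrix (Fin n) (Fin n) ℝ}
    (hQ : Q ∈ Matrix.orthogonalGroup (Fin n) ℝ) :
    toComplex Q ∈ Matrix.unitaryGroup (Fin n) ℂ := by
  rw [Matrix.mem_unitaryGroup_iff, Matrix.star_eq_conjTranspose, ← toComplex_transpose,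
    ← toComplex_mul, ← toComplex_one]
  exact congrArg toComplex ((Matrix.mem_orthogonalGroup_iff _ _).1 hQ)

variable {A B C Q : Matrix (Fin n) (Fin n) ℝ}

theorem isHyperbolicFactorization_toComplex {M L : Matrix (Fin n) (Fin n) ℝ} (hM : IsUnit M)
    (hH : hyperbolicComponent (toComplex A) = toComplex (M * moduliMatrix (toComplex A) * M⁻¹))
    (hL : L.IsLowerTriangular) (hQ : Q ∈ Matrix.orthogonalGroup (Fin n) ℝ)
    (hMC : M⁻¹ * C = L * Q) :
    IsHyperbolicFactorization (toComplex A) (toComplex C) (toComplex M) (toComplex L)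
      (toComplex Q) where
  isUnit := isUnit_toComplex hM
  hyperbolicComponent_eq := by rw [hH, toComplex_mul, toComplex_mul, toComplex_inv hM]
  isLowerTriangular := hL.map Complex.ofRealHom
  mem_unitaryGroup := toComplex_mem_unitaryGroup hQ
  inv_mul_eq := by rw [← toComplex_inv hM, ← toComplex_mul, hMC, toComplex_mul]

theorem IsHyperbolicFactorization.tendsto_absRoot_of_real {M L : Matrix (Fin n) (Fin n) ℂ}
    (h : IsHyperbolicFactorization (toComplex A) (toComplex C) M L (toComplex Q))
    (hB : IsUnit B) (hC : IsUnit C) :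
    Tendsto (fun m : ℕ => absRoot (B * A ^ m * C) m) atTop
      (𝓝 (Qᵀ * moduliMatrix (toComplex A) * Q)) := by
  rw [isEmbedding_toComplex.tendsto_nhds_iff, toComplex_mul, toComplex_mul, toComplex_transpose]
  refine (h.tendsto_absRoot (isUnit_toComplex hB) (isUnit_toComplex hC)).congr' ?_
  filter_upwards [eventually_ne_atTop 0] with m hm
  rw [Function.comp_apply, toComplex_absRoot _ hm, toComplex_mul, toComplex_mul, toComplex_pow]

theorem IsHyperbolicFactorization.conj_eq_of_real {Q' : Matrix (Fin n) (Fin n) ℝ}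
    {M L M' L' : Matrix (Fin n) (Fin n) ℂ}
    (h : IsHyperbolicFactorization (toComplex A) (toComplex C) M L (toComplex Q))
    (h' : IsHyperbolicFactorization (toComplex A) (toComplex C) M' L' (toComplex Q'))
    (hC : IsUnit C) :
    Qᵀ * moduliMatrix (toComplex A) * Q = Q'ᵀ * moduliMatrix (toComplex A) * Q' :=
  tendsto_nhds_unique (h.tendsto_absRoot_of_real isUnit_one hC)
    (h'.tendsto_absRoot_of_real isUnit_one hC)

end RealMatrices

section Diagonalization

variable {ι K : Type*} [Fintype ι] [DecidableEq ι] [Field K]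

theorem roots_charpoly_conjDiagonal (M : (Matrix ι ι K)ˣ) (d : ι → K) :
    (conjDiagonal M d).charpoly.roots = Finset.univ.val.map d := by
  rw [conjDiagonal_apply, ← Matrix.coe_units_inv, Matrix.coe_units_inv, Matrix.charpoly_units_conj,
    Matrix.charpoly_diagonal, Finset.prod_eq_multiset_prod,
    ← Polynomial.roots_multiset_prod_X_sub_C (Finset.univ.val.map d), Multiset.map_map]
  rfl

theorem exists_conjDiagonal_comp_eq (M : (Matrix ι ι K)ˣ) (e : ι ≃ ι) :
    ∃ M' : (Matrix ι ι K)ˣ, ∀ d, conjDiagonal M' (d ∘ e) = conjDiagonal M d := by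
  have hM' : IsUnit ((M : Matrix ι ι K).submatrix (Equiv.refl ι) e) :=
    (Matrix.isUnit_submatrix_equiv _ _).2 M.isUnit
  exact ⟨hM'.unit, fun d =>
    (eq_conjDiagonal_of_mulVec_col fun i => conjDiagonal_mulVec_col M d (e i)).symm⟩

theorem inv_mulVec_conjDiagonal_mulVec (M : (Matrix ι ι K)ˣ) (d x : ι → K) :
    (M : Matrix ι ι K)⁻¹ *ᵥ (conjDiagonal M d *ᵥ x) = d * ((M : Matrix ι ι K)⁻¹ *ᵥ x) := by
  rw [conjDiagonal_apply, ← Matrix.coe_units_inv, Matrix.mulVec_mulVec, Matrix.mul_assoc,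
    Units.inv_mul_cancel_left, ← Matrix.mulVec_mulVec]
  ext i
  rw [Matrix.mulVec_diagonal, Pi.mul_apply]

end Diagonalization

section DiagonalizablePart

variable {n : ℕ} {S N : Matrix (Fin n) (Fin n) ℂ}

theorem IsDiagonalizable.exists_eq_conjDiagonal (hS : IsDiagonalizable S) :
    ∃ (M : (Matrix (Fin n) (Fin n) ℂ)ˣ) (μ : Fin n → ℂ), S = conjDiagonal M μ := by
  obtain ⟨_, ⟨M, rfl⟩, hdiag⟩ := hS
  refine ⟨M, ((M : Matrix (Fin n) (Fin n) ℂ)⁻¹ * S * M).diag, ?_⟩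
  rw [conjDiagonal_apply, hdiag.diagonal_diag, ← Matrix.coe_units_inv, Matrix.mul_assoc,
    Matrix.mul_assoc, Units.mul_inv, Matrix.mul_one, Units.mul_inv_cancel_left]

theorem IsDiagonalizable.exists_norm_eq_eigenvalueModuli (hS : IsDiagonalizable S)
    (hN : IsNilpotent N) (hSN : Commute S N) :
    ∃ (M : (Matrix (Fin n) (Fin n) ℂ)ˣ) (μ : Fin n → ℂ), S = conjDiagonal M μ ∧
      ∀ i, ‖μ i‖ = eigenvalueModuli (S + N) i := by
  obtain ⟨P, δ, rfl⟩ := hS.exists_eq_conjDiagonal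
  have hroots : Finset.univ.val.map (fun i => (eigenvalueModuli (conjDiagonal P δ + N) i : ℂ)) =
      Finset.univ.val.map (fun i => ((‖δ i‖ : ℝ) : ℂ)) := by
    obtain ⟨_, ⟨M, rfl⟩, hH⟩ := exists_hyperbolicComponent_eq (conjDiagonal P δ + N)
    rw [toComplex_moduliMatrix, ← conjDiagonal_apply,
      hyperbolicComponent_conjDiagonal_add hN hSN] at hH
    rw [← roots_charpoly_conjDiagonal M, ← hH, roots_charpoly_conjDiagonal]
  obtain ⟨e, he⟩ := exists_equiv_of_map_univ_eq _ _ hroots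
  obtain ⟨M, hM⟩ := exists_conjDiagonal_comp_eq P e
  exact ⟨M, δ ∘ e, (hM δ).symm, fun i => Complex.ofReal_injective (he i)⟩

end DiagonalizablePart

theorem setOf_le_sdiff_setOf_add_one_le {ι : Type*} {s : ℕ} (κ : ι → Fin s) (j : Fin s) :
    {i | (j : ℕ) ≤ κ i} \ {i | (j : ℕ) + 1 ≤ κ i} = {i | κ i = j} := by
  ext i
  simp only [Set.mem_sdiff, Set.mem_ofPred_eq, Fin.ext_iff]
  omega

section SupportProjection

variable {ι 𝕜 : Type*} [Fintype ι] [DecidableEq ι] [RCLike 𝕜]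

/-- The orthogonal projection onto the vectors whose coordinates vanish off `s`, the coordinates of
`x` being the entries of `Q x` for a unitary matrix `Q`. -/
def supportProjection (Q : Matrix ι ι 𝕜) (s : Set ι) : Matrix ι ι 𝕜 :=
  Qᴴ * Matrix.diagonal (s.indicator 1) * Q

theorem diagonal_indicator_one_mulVec (s : Set ι) (y : ι → 𝕜) :
    Matrix.diagonal (s.indicator 1) *ᵥ y = s.indicator y := by
  ext i
  by_cases hi : i ∈ s <;> simp [Matrix.mulVec_diagonal, hi]

theorem isStarProjection_diagonal_indicator_one (s : Set ι) :
    IsStarProjection (Matrix.diagonal (s.indicator 1) : Matrix ι ι 𝕜) := by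
  constructor
  · rw [IsIdempotentElem, Matrix.diagonal_mul_diagonal']
    congr 1
    ext i
    by_cases hi : i ∈ s <;> simp [hi]
  · rw [IsSelfAdjoint, Matrix.star_eq_conjTranspose, Matrix.diagonal_conjTranspose]
    congr 1
    ext i
    by_cases hi : i ∈ s <;> simp [hi]

variable {Q : Matrix ι ι 𝕜}

theorem isStarProjection_supportProjection (hQ : Q ∈ Matrix.unitaryGroup ι 𝕜) (s : Set ι) :
    IsStarProjection (supportProjection Q s) := by
  obtain ⟨hidem, hself⟩ := isStarProjection_diagonal_indicator_one (𝕜 := 𝕜) s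
  refine ⟨?_, hself.conjugate' Q⟩
  calc Qᴴ * Matrix.diagonal (s.indicator 1) * Q * (Qᴴ * Matrix.diagonal (s.indicator 1) * Q)
      = Qᴴ * (Matrix.diagonal (s.indicator 1) * (Q * star Q) *
          Matrix.diagonal (s.indicator 1)) * Q := by
        simp only [Matrix.mul_assoc, Matrix.star_eq_conjTranspose]
    _ = Qᴴ * Matrix.diagonal (s.indicator 1) * Q := by
        rw [Matrix.mem_unitaryGroup_iff.1 hQ, Matrix.mul_one, hidem.eq]

theorem supportProjection_mulVec_eq_self_iff (hQ : Q ∈ Matrix.unitaryGroup ι 𝕜) {s : Set ι}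
    {x : ι → 𝕜} : supportProjection Q s *ᵥ x = x ↔ Function.support (Q *ᵥ x) ⊆ s := by
  have hQinj : Function.Injective (Q *ᵥ ·) :=
    Function.LeftInverse.injective (g := (star Q *ᵥ ·)) fun y => by
      simp only [Matrix.mulVec_mulVec, Matrix.mem_unitaryGroup_iff'.1 hQ, Matrix.one_mulVec]
  rw [← Set.indicator_eq_self, ← diagonal_indicator_one_mulVec, ← hQinj.eq_iff, supportProjection,
    Matrix.mulVec_mulVec, Matrix.mul_assoc, ← Matrix.mul_assoc Q, ← Matrix.star_eq_conjTranspose,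
    Matrix.mem_unitaryGroup_iff.1 hQ, Matrix.one_mul, Matrix.mulVec_mulVec]

theorem mem_range_toEuclideanCLM_supportProjection_iff (hQ : Q ∈ Matrix.unitaryGroup ι 𝕜)
    {s : Set ι} {x : EuclideanSpace 𝕜 ι} :
    x ∈ (Matrix.toEuclideanCLM (𝕜 := 𝕜) (supportProjection Q s)).range ↔
      Function.support (Q *ᵥ x.ofLp) ⊆ s := by
  have hidem := (isStarProjection_supportProjection hQ s).map (Matrix.toEuclideanCLM (𝕜 := 𝕜))
  rw [← supportProjection_mulVec_eq_self_iff hQ, ← Matrix.ofLp_toEuclideanCLM,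
    (WithLp.ofLp_injective 2).eq_iff]
  exact LinearMap.IsIdempotentElem.mem_range_iff
    (congrArg ContinuousLinearMap.toLinearMap hidem.isIdempotentElem.eq)

theorem symm_starProjection_eq_supportProjection (hQ : Q ∈ Matrix.unitaryGroup ι 𝕜) {s : Set ι}
    {V : Submodule 𝕜 (EuclideanSpace 𝕜 ι)}
    (hV : ∀ x, x ∈ V ↔ Function.support (Q *ᵥ x.ofLp) ⊆ s) :
    (Matrix.toEuclideanCLM (𝕜 := 𝕜) (n := ι)).symm V.starProjection = supportProjection Q s := by
  have hrange : (Matrix.toEuclideanCLM (𝕜 := 𝕜) (supportProjection Q s)).range = V := by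
    ext x
    rw [mem_range_toEuclideanCLM_supportProjection_iff hQ, hV]
  obtain ⟨_, hproj⟩ := isStarProjection_iff_eq_starProjection_range.1
    ((isStarProjection_supportProjection hQ s).map (Matrix.toEuclideanCLM (𝕜 := 𝕜)))
  rw [StarAlgEquiv.symm_apply_eq, hproj]
  simp only [hrange]

theorem supportProjection_sub {s t : Set ι} (hts : t ⊆ s) :
    supportProjection Q s - supportProjection Q t = supportProjection Q (s \ t) := by
  rw [supportProjection, supportProjection, supportProjection, ← Matrix.sub_mul, ← Matrix.mul_sub,
    Matrix.diagonal_sub, Set.indicator_sdiff hts]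
  rfl

theorem sum_smul_supportProjection_fiber {σ : Type*} [Fintype σ] (c : σ → 𝕜) (κ : ι → σ) :
    ∑ j, c j • supportProjection Q {i | κ i = j} = Qᴴ * Matrix.diagonal (c ∘ κ) * Q := by
  have hdiag : ∑ j, c j • Matrix.diagonal ({i | κ i = j}.indicator 1) =
      Matrix.diagonal (c ∘ κ) := by
    classical
    simp_rw [← Matrix.diagonal_smul]
    ext a b
    by_cases hab : a = b <;>
      simp [Matrix.sum_apply, hab, Set.indicator_apply]
  simp only [supportProjection, ← hdiag, Matrix.mul_sum, Matrix.sum_mul, Matrix.mul_smul,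
    Matrix.smul_mul]

theorem sum_smul_supportProjection_sub {s : ℕ} (c : Fin s → 𝕜) (κ : ι → Fin s) :
    ∑ j, c j • (supportProjection Q {i | (j : ℕ) ≤ κ i} -
      supportProjection Q {i | (j : ℕ) + 1 ≤ κ i}) = Qᴴ * Matrix.diagonal (c ∘ κ) * Q := by
  have hsub (j : Fin s) : {i | (j : ℕ) + 1 ≤ κ i} ⊆ {i | (j : ℕ) ≤ κ i} :=
    fun i hi => (Nat.le_succ _).trans hi
  simp only [supportProjection_sub (hsub _), setOf_le_sdiff_setOf_add_one_le,
    sum_smul_supportProjection_fiber]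

end SupportProjection

section EigenvectorSpan

variable {ι 𝕜 : Type*} [Fintype ι] [DecidableEq ι] [RCLike 𝕜]

theorem mem_span_eigenvectors_conjDiagonal_iff (M : (Matrix ι ι 𝕜)ˣ) (μ : ι → 𝕜) (p : Set 𝕜)
    {x : EuclideanSpace 𝕜 ι} :
    x ∈ Submodule.span 𝕜 {x : EuclideanSpace 𝕜 ι |
        ∃ ν ∈ p, Matrix.toEuclideanCLM (𝕜 := 𝕜) (conjDiagonal M μ) x = ν • x} ↔
      Function.support ((M : Matrix ι ι 𝕜)⁻¹ *ᵥ x.ofLp) ⊆ μ ⁻¹' p := by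
  constructor
  · intro hx
    induction hx using Submodule.span_induction with
    | mem x hx =>
      obtain ⟨ν, hν, hxν⟩ := hx
      intro i hi
      have hi' := congrFun (inv_mulVec_conjDiagonal_mulVec M μ x.ofLp) i
      rw [← Matrix.ofLp_toEuclideanCLM (conjDiagonal M μ), hxν, WithLp.ofLp_smul,
        Matrix.mulVec_smul] at hi'
      rwa [Set.mem_preimage, ← mul_right_cancel₀ hi hi']
    | zero => simp
    | add x y _ _ hx hy =>
      rw [WithLp.ofLp_add, Matrix.mulVec_add]
      exact (Function.support_add _ _).trans (Set.union_subset hx hy)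
    | smul c x _ hx =>
      rw [WithLp.ofLp_smul, Matrix.mulVec_smul]
      exact (Function.support_const_smul_subset _ _).trans hx
  · intro hx
    have hsum : x = ∑ i, ((M : Matrix ι ι 𝕜)⁻¹ *ᵥ x.ofLp) i •
        WithLp.toLp 2 ((M : Matrix ι ι 𝕜).col i) := by
      apply WithLp.ofLp_injective 2
      calc x.ofLp = (M : Matrix ι ι 𝕜) *ᵥ ((M : Matrix ι ι 𝕜)⁻¹ *ᵥ x.ofLp) := by
            rw [← Matrix.coe_units_inv, Matrix.mulVec_mulVec, Units.mul_inv, Matrix.one_mulVec]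
        _ = _ := by
            rw [Matrix.mulVec_eq_sum, WithLp.ofLp_sum]
            simp only [op_smul_eq_smul, WithLp.ofLp_smul]
            rfl
    rw [hsum]
    refine Submodule.sum_mem _ fun i _ => ?_
    by_cases hi : ((M : Matrix ι ι 𝕜)⁻¹ *ᵥ x.ofLp) i = 0
    · simp [hi]
    · refine Submodule.smul_mem _ _ (Submodule.subset_span ⟨μ i, hx hi, ?_⟩)
      apply WithLp.ofLp_injective 2
      rw [Matrix.ofLp_toEuclideanCLM, conjDiagonal_mulVec_col, WithLp.ofLp_smul]

end EigenvectorSpan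

section TriangularSupport

variable {ι K : Type*} [Fintype ι] [LinearOrder ι] [Field K] {L : Matrix ι ι K} {s : Set ι}
  {z : ι → K}

theorem support_mulVec_subset_of_isLowerTriangular (hL : L.IsLowerTriangular) (hs : IsUpperSet s)
    (hz : Function.support z ⊆ s) : Function.support (L *ᵥ z) ⊆ s := by
  intro i hi
  obtain ⟨j, -, hj⟩ := Finset.exists_ne_zero_of_sum_ne_zero (s := Finset.univ)
    (f := fun j => L i j * z j) hi
  have hji : j ≤ i := by
    by_contra! hij
    exact hj (by rw [hL hij, zero_mul])
  exact hs hji (hz (right_ne_zero_of_mul hj))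

theorem support_mulVec_subset_iff_of_isLowerTriangular (hL : L.IsLowerTriangular)
    (hunit : IsUnit L) (hs : IsUpperSet s) :
    Function.support (L *ᵥ z) ⊆ s ↔ Function.support z ⊆ s := by
  refine ⟨fun hz => ?_, support_mulVec_subset_of_isLowerTriangular hL hs⟩
  have hinv : L⁻¹ *ᵥ (L *ᵥ z) = z := by
    rw [Matrix.mulVec_mulVec, Matrix.nonsing_inv_mul _ ((Matrix.isUnit_iff_isUnit_det L).1 hunit),
      Matrix.one_mulVec]
  rw [← hinv]
  exact support_mulVec_subset_of_isLowerTriangular (isLowerTriangular_inv hL hunit) hs hz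

end TriangularSupport

section SpectralProjections

variable {n : ℕ} {S N : Matrix (Fin n) (Fin n) ℂ}

theorem IsDiagonalizable.exists_spectralProjection_eq (hS : IsDiagonalizable S)
    (hN : IsNilpotent N) (hSN : Commute S N) :
    ∃ M L Q, IsHyperbolicFactorization (S + N) 1 M L Q ∧
      ∀ t, spectralProjection S t = supportProjection Q {i | eigenvalueModuli (S + N) i ≤ t} := by
  obtain ⟨M, μ, rfl, hμ⟩ := hS.exists_norm_eq_eigenvalueModuli hN hSN
  obtain ⟨L, Q, hL, hQ, hLQ⟩ :=
    exists_lowerTriangular_mul_unitary ((M : Matrix (Fin n) (Fin n) ℂ)⁻¹ * 1)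
  have hfac : IsHyperbolicFactorization (conjDiagonal M μ + N) 1 M L Q := by
    refine ⟨M.isUnit, ?_, hL, hQ, hLQ⟩
    rw [hyperbolicComponent_conjDiagonal_add hN hSN, conjDiagonal_apply, toComplex_moduliMatrix]
    simp only [hμ]
  refine ⟨M, L, Q, hfac, fun t => symm_starProjection_eq_supportProjection hQ fun x => ?_⟩
  have hupper : IsUpperSet {i | eigenvalueModuli (conjDiagonal M μ + N) i ≤ t} :=
    fun _ _ hij hi => (eigenvalueModuli_antitone _ hij).trans hi
  rw [← support_mulVec_subset_iff_of_isLowerTriangular hL (hfac.isUnit_lower isUnit_one) hupper,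
    Matrix.mulVec_mulVec, ← hLQ, Matrix.mul_one]
  simp only [← hμ]
  exact mem_span_eigenvectors_conjDiagonal_iff M μ {ν | ‖ν‖ ≤ t}

theorem exists_comp_eq_eigenvalueModuli {A : Matrix (Fin n) (Fin n) ℂ} {σ : Type*} {γ : σ → ℝ}
    (hγ : Set.range γ = {r : ℝ | ∃ μ ∈ spectrum ℂ A, ‖μ‖ = r}) :
    ∃ κ : Fin n → σ, γ ∘ κ = eigenvalueModuli A := by
  have hmem (i : Fin n) : eigenvalueModuli A i ∈ Set.range γ := by
    obtain ⟨z, hz, hzi⟩ := exists_mem_spectrum_norm_eq_eigenvalueModuli A i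
    exact hγ ▸ ⟨z, hz, hzi⟩
  choose κ hκ using hmem
  exact ⟨κ, funext hκ⟩

theorem imageOf_spectralProjection (S : Matrix (Fin n) (Fin n) ℂ) (t : ℝ) :
    imageOf (spectralProjection S t) = Submodule.span ℂ {x : EuclideanSpace ℂ (Fin n) |
      ∃ μ : ℂ, ‖μ‖ ≤ t ∧ Matrix.toEuclideanCLM (𝕜 := ℂ) S x = μ • x} := by
  rw [imageOf, spectralProjection, StarAlgEquiv.apply_symm_apply]
  exact congrArg SetLike.coe (Submodule.range_starProjection _)

theorem mapsTo_imageOf_spectralProjection {B : Matrix (Fin n) (Fin n) ℂ} (hBS : Commute B S)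
    (t : ℝ) :
    Set.MapsTo (Matrix.toEuclideanCLM (𝕜 := ℂ) B) (imageOf (spectralProjection S t))
      (imageOf (spectralProjection S t)) := by
  rw [imageOf_spectralProjection]
  intro x hx
  refine Submodule.span_le (p := (Submodule.span ℂ _).comap
    (Matrix.toEuclideanCLM (𝕜 := ℂ) B).toLinearMap) |>.2 ?_ hx
  rintro y ⟨μ, hμ, hy⟩
  refine Submodule.subset_span ⟨μ, hμ, ?_⟩
  have hcomm := DFunLike.congr_fun (hBS.map (Matrix.toEuclideanCLM (𝕜 := ℂ) (n := Fin n))).eq y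
  simpa [hy] using hcomm.symm

theorem mapsTo_imageOf_nayakProjection {B : Matrix (Fin n) (Fin n) ℂ} (hBS : Commute B S) {s : ℕ}
    {γ : Fin s → ℝ} (k : ℕ) :
    Set.MapsTo (Matrix.toEuclideanCLM (𝕜 := ℂ) B) (imageOf (nayakProjection S γ k))
      (imageOf (nayakProjection S γ k)) := by
  rw [nayakProjection]
  split
  · exact mapsTo_imageOf_spectralProjection hBS _
  · rintro _ ⟨x, rfl⟩
    exact ⟨0, by simp⟩

end SpectralProjections

theorem nonneg_of_isGreatest_image {α : Type*} {d : α → ℝ} {r : ℝ} (hd : 0 ≤ d) {t : Set α}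
    (hr : IsGreatest (d '' t) r) : 0 ≤ r := by
  obtain ⟨i, -, rfl⟩ := hr.1
  exact hd i

section DiagonalOrbits

variable {ι 𝕜 : Type*} [Fintype ι] [DecidableEq ι] [RCLike 𝕜] {d : ι → ℝ} {r : ℝ}
  {y : EuclideanSpace 𝕜 ι}

theorem toEuclideanCLM_diagonal_pow_apply (d : ι → ℝ) (y : EuclideanSpace 𝕜 ι) (m : ℕ) (i : ι) :
    Matrix.toEuclideanCLM (𝕜 := 𝕜) (Matrix.diagonal (fun i => (d i : 𝕜)) ^ m) y i =
      (d i : 𝕜) ^ m * y i := by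
  rw [Matrix.diagonal_pow, Matrix.ofLp_toEuclideanCLM, Matrix.mulVec_diagonal, Pi.pow_apply]

theorem norm_diagonal_pow_apply_le (hd : 0 ≤ d)
    (hr : IsGreatest (d '' Function.support y.ofLp) r) (m : ℕ) :
    ‖Matrix.toEuclideanCLM (𝕜 := 𝕜) (Matrix.diagonal (fun i => (d i : 𝕜)) ^ m) y‖ ≤
      ‖y‖ * r ^ m := by
  have hr0 : 0 ≤ r := nonneg_of_isGreatest_image hd hr
  have hentry (i : ι) : ‖(d i : 𝕜) ^ m * y i‖ ≤ r ^ m * ‖y i‖ := by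
    by_cases hi : y i = 0
    · simp [hi]
    · rw [norm_mul, norm_pow, RCLike.norm_of_nonneg (hd i)]
      gcongr
      exacts [hd i, hr.2 ⟨i, hi, rfl⟩]
  calc _ ≤ ‖((r : 𝕜) ^ m) • y‖ := by
        rw [EuclideanSpace.norm_eq, EuclideanSpace.norm_eq]
        gcongr with i
        rw [toEuclideanCLM_diagonal_pow_apply]
        simpa [abs_of_nonneg hr0] using hentry i
    _ = ‖y‖ * r ^ m := by
        rw [norm_smul, norm_pow, RCLike.norm_of_nonneg hr0, mul_comm]

theorem exists_pow_le_mul_norm_diagonal_pow_apply (hd : 0 ≤ d)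
    (hr : IsGreatest (d '' Function.support y.ofLp) r) :
    ∃ c : ℝ, 0 ≤ c ∧ ∀ m : ℕ, r ^ m ≤
      c * ‖Matrix.toEuclideanCLM (𝕜 := 𝕜) (Matrix.diagonal (fun i => (d i : 𝕜)) ^ m) y‖ := by
  obtain ⟨i, hi, rfl⟩ := hr.1
  have hyi : 0 < ‖y i‖ := norm_pos_iff.2 hi
  refine ⟨‖y i‖⁻¹, by positivity, fun m => ?_⟩
  rw [le_inv_mul_iff₀ hyi, mul_comm]
  calc d i ^ m * ‖y i‖ = ‖(d i : 𝕜) ^ m * y i‖ := by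
        rw [norm_mul, norm_pow, RCLike.norm_of_nonneg (hd i)]
    _ ≤ _ := by
        rw [← toEuclideanCLM_diagonal_pow_apply]
        exact PiLp.norm_apply_le _ i

open scoped Matrix.Norms.L2Operator in
theorem tendsto_norm_rpow_of_eventually_eq_apply {v : ℕ → (Matrix ι ι 𝕜)ˣ}
    (hv : v ∈ subexpUnits (Matrix ι ι 𝕜)) {w z : ℕ → EuclideanSpace 𝕜 ι} {b c : ℝ}
    (hw : ∀ᶠ m in atTop, w m = Matrix.toEuclideanCLM (𝕜 := 𝕜) (v m : Matrix ι ι 𝕜) (z m))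
    (hr : 0 ≤ r) (hle : ∀ m, ‖z m‖ ≤ b * r ^ m) (hc : 0 ≤ c) (hge : ∀ m, r ^ m ≤ c * ‖z m‖) :
    Tendsto (fun m : ℕ => ‖w m‖ ^ (1 / (m : ℝ))) atTop (𝓝 r) := by
  refine tendsto_rpow_one_div_of_le_mul (fun m => norm_nonneg (w m)) hr
    (hv.1.norm.mul (.const b)) ((SubexpGrowth.const c).mul hv.2.norm) ?_ ?_
  · filter_upwards [hw] with m hm
    calc ‖w m‖ ≤ ‖(v m : Matrix ι ι 𝕜)‖ * ‖z m‖ := hm ▸ ContinuousLinearMap.le_opNorm _ _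
      _ ≤ ‖(v m : Matrix ι ι 𝕜)‖ * (b * r ^ m) := by gcongr; exact hle m
      _ = ‖(v m : Matrix ι ι 𝕜)‖ * b * r ^ m := (mul_assoc _ _ _).symm
  · filter_upwards [hw] with m hm
    have hz : z m = Matrix.toEuclideanCLM (𝕜 := 𝕜) (↑(v m)⁻¹ : Matrix ι ι 𝕜) (w m) := by
      rw [hm, ← mul_apply_eq_comp, ← map_mul, Units.inv_mul, map_one]
      rfl
    calc r ^ m ≤ c * ‖z m‖ := hge m
      _ ≤ c * (‖(↑(v m)⁻¹ : Matrix ι ι 𝕜)‖ * ‖w m‖) := by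
        gcongr
        exact hz ▸ ContinuousLinearMap.le_opNorm _ _
      _ = c * ‖(↑(v m)⁻¹ : Matrix ι ι 𝕜)‖ * ‖w m‖ := (mul_assoc _ _ _).symm

end DiagonalOrbits

theorem tendsto_rpow_one_div_add {a : ℕ → ℝ} {r : ℝ} (ha : 0 ≤ a) (k : ℕ)
    (h : Tendsto (fun m : ℕ => a m ^ (1 / (m : ℝ))) atTop (𝓝 r)) :
    Tendsto (fun m : ℕ => a (m + k) ^ (1 / (m : ℝ))) atTop (𝓝 r) := by
  have hexp : Tendsto (fun m : ℕ => 1 + (k : ℝ) / m) atTop (𝓝 1) := by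
    simpa using tendsto_const_nhds.add (tendsto_const_div_atTop_nhds_zero_nat (k : ℝ))
  have hpow := ((tendsto_add_atTop_iff_nat k).2 h).rpow hexp (Or.inr one_pos)
  rw [Real.rpow_one] at hpow
  refine hpow.congr' ?_
  filter_upwards [eventually_ne_atTop 0] with m hm
  rw [← Real.rpow_mul (ha _)]
  congr 1
  push_cast
  field_simp

section Orbits

variable {n : ℕ} {A M L Q : Matrix (Fin n) (Fin n) ℂ} {x : EuclideanSpace ℂ (Fin n)} {r : ℝ}

theorem IsHyperbolicFactorization.tendsto_norm_pow (h : IsHyperbolicFactorization A 1 M L Q)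
    (hr : IsGreatest (eigenvalueModuli A '' Function.support (Q *ᵥ x.ofLp)) r) :
    Tendsto (fun m : ℕ => ‖Matrix.toEuclideanCLM (𝕜 := ℂ) (A ^ m) x‖ ^ (1 / (m : ℝ))) atTop
      (𝓝 r) := by
  obtain ⟨v, hv, hA⟩ := h.exists_subexpUnits_mul_pow_mul_eq isUnit_one isUnit_one
  set y : EuclideanSpace ℂ (Fin n) := Matrix.toEuclideanCLM (𝕜 := ℂ) Q x
  have hnonneg := eigenvalueModuli_nonneg A
  obtain ⟨c, hc, hlower⟩ := exists_pow_le_mul_norm_diagonal_pow_apply (y := y) hnonneg hr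
  refine tendsto_norm_rpow_of_eventually_eq_apply hv ?_ (nonneg_of_isGreatest_image hnonneg hr)
    (norm_diagonal_pow_apply_le (y := y) hnonneg hr) hc hlower
  filter_upwards [hA] with m hm
  rw [Matrix.one_mul, Matrix.mul_one, toComplex_moduliMatrix] at hm
  rw [hm, map_mul, map_mul]
  rfl

theorem tendsto_norm_pow_apply_pow (k : ℕ)
    (h : Tendsto (fun m : ℕ => ‖Matrix.toEuclideanCLM (𝕜 := ℂ) (A ^ m) x‖ ^ (1 / (m : ℝ))) atTop
      (𝓝 r)) :
    Tendsto (fun m : ℕ => ‖Matrix.toEuclideanCLM (𝕜 := ℂ) (A ^ m)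
      (Matrix.toEuclideanCLM (𝕜 := ℂ) (A ^ k) x)‖ ^ (1 / (m : ℝ))) atTop (𝓝 r) := by
  refine (tendsto_rpow_one_div_add (fun m => norm_nonneg _) k h).congr fun m => ?_
  rw [pow_add, map_mul]
  rfl

theorem pow_apply_ne_zero_of_tendsto (hr : r ≠ 0) (k : ℕ)
    (h : Tendsto (fun m : ℕ => ‖Matrix.toEuclideanCLM (𝕜 := ℂ) (A ^ m) x‖ ^ (1 / (m : ℝ))) atTop
      (𝓝 r)) :
    Matrix.toEuclideanCLM (𝕜 := ℂ) (A ^ k) x ≠ 0 := by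
  intro hzero
  have hlim := tendsto_norm_pow_apply_pow k h
  have hlim0 : Tendsto (fun m : ℕ => ‖Matrix.toEuclideanCLM (𝕜 := ℂ) (A ^ m)
      (Matrix.toEuclideanCLM (𝕜 := ℂ) (A ^ k) x)‖ ^ (1 / (m : ℝ))) atTop (𝓝 0) := by
    refine tendsto_const_nhds.congr' ?_
    filter_upwards [eventually_ne_atTop 0] with m hm
    rw [hzero, map_zero, norm_zero, Real.zero_rpow (by simpa using hm)]
  exact hr (tendsto_nhds_unique hlim hlim0)

end Orbits

section Layers

variable {n s : ℕ} {A S M L Q : Matrix (Fin n) (Fin n) ℂ} {κ : Fin n → Fin s} {γ : Fin s → ℝ}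
  {j : Fin s} {x : EuclideanSpace ℂ (Fin n)}

theorem nayakProjection_eq_supportProjection {d : Fin n → ℝ}
    (hE : ∀ t, spectralProjection S t = supportProjection Q {i | d i ≤ t}) (hγ : StrictAnti γ)
    (hκ : γ ∘ κ = d) (k : ℕ) : nayakProjection S γ k = supportProjection Q {i | k ≤ κ i} := by
  subst hκ
  by_cases hk : k < s
  · rw [nayakProjection, dif_pos hk, hE]
    simp only [Function.comp_apply, hγ.le_iff_ge, Fin.le_def]
  · have hempty : {i | k ≤ κ i} = ∅ :=
      Set.eq_empty_of_forall_notMem fun i hi => hk (lt_of_le_of_lt hi (κ i).isLt)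
    simp [nayakProjection, hk, hempty, supportProjection]

theorem sum_smul_nayakProjection_sub
    (hE : ∀ t, spectralProjection S t = supportProjection Q {i | eigenvalueModuli A i ≤ t})
    (hγ : StrictAnti γ) (hκ : γ ∘ κ = eigenvalueModuli A) :
    ∑ j : Fin s, (γ j : ℂ) • (nayakProjection S γ j - nayakProjection S γ (j + 1)) =
      Qᴴ * toComplex (moduliMatrix A) * Q := by
  simp only [nayakProjection_eq_supportProjection hE hγ hκ, toComplex_moduliMatrix, ← hκ]
  exact sum_smul_supportProjection_sub _ κ

theorem mem_imageOf_nayakProjection_sdiff_iff (hQ : Q ∈ Matrix.unitaryGroup (Fin n) ℂ)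
    {d : Fin n → ℝ} (hE : ∀ t, spectralProjection S t = supportProjection Q {i | d i ≤ t})
    (hγ : StrictAnti γ) (hκ : γ ∘ κ = d) :
    x ∈ imageOf (nayakProjection S γ j) \ imageOf (nayakProjection S γ (j + 1)) ↔
      IsLeast (κ '' Function.support (Q *ᵥ x.ofLp)) j := by
  have hmem (k : ℕ) : x ∈ imageOf (nayakProjection S γ k) ↔
      ∀ i, (Q *ᵥ x.ofLp) i ≠ 0 → k ≤ κ i := by
    rw [nayakProjection_eq_supportProjection hE hγ hκ]
    exact mem_range_toEuclideanCLM_supportProjection_iff hQ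
  rw [Set.mem_sdiff, hmem, hmem]
  constructor
  · rintro ⟨hle, hlt⟩
    push Not at hlt
    obtain ⟨i, hi, hij⟩ := hlt
    exact ⟨⟨i, hi, Fin.ext ((Nat.lt_succ_iff.1 hij).antisymm (hle i hi))⟩,
      Set.forall_mem_image.2 hle⟩
  · rintro ⟨⟨i, hi, rfl⟩, hle⟩
    exact ⟨fun l hl => hle ⟨l, hl, rfl⟩, fun hlt => (hlt i hi).not_gt (Nat.lt_succ_self _)⟩

theorem IsHyperbolicFactorization.tendsto_norm_pow_of_isLeast
    (h : IsHyperbolicFactorization A 1 M L Q) (hγ : StrictAnti γ)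
    (hκ : γ ∘ κ = eigenvalueModuli A) (hj : IsLeast (κ '' Function.support (Q *ᵥ x.ofLp)) j) :
    Tendsto (fun m : ℕ => ‖Matrix.toEuclideanCLM (𝕜 := ℂ) (A ^ m) x‖ ^ (1 / (m : ℝ))) atTop
      (𝓝 (γ j)) := by
  refine h.tendsto_norm_pow ?_
  rw [← hκ, Set.image_comp]
  exact hγ.antitone.map_isLeast hj

theorem IsHyperbolicFactorization.isLeast_iff_tendsto_norm_pow
    (h : IsHyperbolicFactorization A 1 M L Q) (hγ : StrictAnti γ)
    (hκ : γ ∘ κ = eigenvalueModuli A) (hx : x ≠ 0) :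
    IsLeast (κ '' Function.support (Q *ᵥ x.ofLp)) j ↔
      Tendsto (fun m : ℕ => ‖Matrix.toEuclideanCLM (𝕜 := ℂ) (A ^ m) x‖ ^ (1 / (m : ℝ))) atTop
        (𝓝 (γ j)) := by
  refine ⟨h.tendsto_norm_pow_of_isLeast hγ hκ, fun hj => ?_⟩
  have hQx : Q *ᵥ x.ofLp ≠ 0 := fun hzero => hx <| WithLp.ofLp_injective 2 <| by
    rw [← Matrix.one_mulVec x.ofLp, ← Matrix.mem_unitaryGroup_iff'.1 h.mem_unitaryGroup,
      ← Matrix.mulVec_mulVec, hzero, Matrix.mulVec_zero, WithLp.ofLp_zero]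
  obtain ⟨l, hl⟩ := (Set.toFinite _).isCompact.exists_isLeast
    ((Function.support_nonempty_iff.2 hQx).image κ)
  rwa [hγ.injective (tendsto_nhds_unique hj (h.tendsto_norm_pow_of_isLeast hγ hκ hl))]

theorem IsHyperbolicFactorization.isLeast_pow_apply (h : IsHyperbolicFactorization A 1 M L Q)
    (hγ : StrictAnti γ) (hκ : γ ∘ κ = eigenvalueModuli A) (hγj : γ j ≠ 0) (k : ℕ)
    (hj : IsLeast (κ '' Function.support (Q *ᵥ x.ofLp)) j) :
    IsLeast (κ '' Function.support
      (Q *ᵥ (Matrix.toEuclideanCLM (𝕜 := ℂ) (A ^ k) x).ofLp)) j := by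
  have hlim := h.tendsto_norm_pow_of_isLeast hγ hκ hj
  exact (h.isLeast_iff_tendsto_norm_pow hγ hκ (pow_apply_ne_zero_of_tendsto hγj k hlim)).2
    (tendsto_norm_pow_apply_pow k hlim)

end Layers

end MatrixPowers
end

open MatrixPowers Matrix in
theorem mainTheorem1 (n : ℕ) :
    -- complex matrices
    (∀ A C : Matrix (Fin n) (Fin n) ℂ, IsUnit C →
      (∃ M : Matrix (Fin n) (Fin n) ℂ, IsUnit M ∧
        hyperbolicComponent A = M * toComplex (moduliMatrix A) * M⁻¹) ∧
      (∀ M : Matrix (Fin n) (Fin n) ℂ, IsUnit M →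
        ∃ L Q : Matrix (Fin n) (Fin n) ℂ,
          L.IsLowerTriangular ∧ Q ∈ unitaryGroup (Fin n) ℂ ∧ M⁻¹ * C = L * Q) ∧
      ∃ X : Matrix (Fin n) (Fin n) ℂ, ∀ B M L Q : Matrix (Fin n) (Fin n) ℂ,
        IsUnit B → IsUnit M →
        hyperbolicComponent A = M * toComplex (moduliMatrix A) * M⁻¹ →
        L.IsLowerTriangular → Q ∈ unitaryGroup (Fin n) ℂ → M⁻¹ * C = L * Q →
        Tendsto (fun m : ℕ => absRoot (B * A ^ m * C) m) atTop
            (𝓝 (Qᴴ * toComplex (moduliMatrix A) * Q)) ∧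
          Qᴴ * toComplex (moduliMatrix A) * Q = X) ∧
    -- real matrices
    (∀ A C : Matrix (Fin n) (Fin n) ℝ, IsUnit C →
      (∃ M : Matrix (Fin n) (Fin n) ℝ, IsUnit M ∧
        hyperbolicComponent (toComplex A) =
          toComplex (M * moduliMatrix (toComplex A) * M⁻¹)) ∧
      (∀ M : Matrix (Fin n) (Fin n) ℝ, IsUnit M →
        ∃ L Q : Matrix (Fin n) (Fin n) ℝ,
          L.IsLowerTriangular ∧ Q ∈ orthogonalGroup (Fin n) ℝ ∧ M⁻¹ * C = L * Q) ∧
      ∃ X : Matrix (Fin n) (Fin n) ℝ, ∀ B M L Q : Matrix (Fin n) (Fin n) ℝ,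
        IsUnit B → IsUnit M →
        hyperbolicComponent (toComplex A) =
          toComplex (M * moduliMatrix (toComplex A) * M⁻¹) →
        L.IsLowerTriangular → Q ∈ orthogonalGroup (Fin n) ℝ → M⁻¹ * C = L * Q →
        Tendsto (fun m : ℕ => absRoot (B * A ^ m * C) m) atTop
            (𝓝 (Qᵀ * moduliMatrix (toComplex A) * Q)) ∧
          Qᵀ * moduliMatrix (toComplex A) * Q = X) ∧
    -- Nayak's theorem
    (∀ A S N : Matrix (Fin n) (Fin n) ℂ,
      A = S + N → Commute S N → IsDiagonalizable S → IsNilpotent N →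
      ∀ (s : ℕ) (γ : Fin s → ℝ), StrictAnti γ →
        Set.range γ = {r : ℝ | ∃ μ ∈ spectrum ℂ A, ‖μ‖ = r} →
        ((∑ j : Fin s,
            (γ j : ℂ) • (nayakProjection S γ j - nayakProjection S γ (j + 1))).PosSemidef ∧
          Tendsto (fun m : ℕ => absRoot (A ^ m) m) atTop
            (𝓝 (∑ j : Fin s,
              (γ j : ℂ) • (nayakProjection S γ j - nayakProjection S γ (j + 1))))) ∧
        (∀ (j : Fin s) (x : EuclideanSpace ℂ (Fin n)), x ≠ 0 →
          (x ∈ imageOf (nayakProjection S γ j) \ imageOf (nayakProjection S γ (j + 1)) ↔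
            Tendsto (fun m : ℕ => ‖toEuclideanCLM (𝕜 := ℂ) (A ^ m) x‖ ^ (1 / (m : ℝ))) atTop
              (𝓝 (γ j)))) ∧
        (∀ (j : Fin s) (k : ℕ),
          Set.MapsTo (toEuclideanCLM (𝕜 := ℂ) (A ^ k))
            (imageOf (nayakProjection S γ j)) (imageOf (nayakProjection S γ j)) ∧
          (0 < γ j →
            Set.MapsTo (toEuclideanCLM (𝕜 := ℂ) (A ^ k))
              (imageOf (nayakProjection S γ j) \ imageOf (nayakProjection S γ (j + 1)))
              (imageOf (nayakProjection S γ j) \ imageOf (nayakProjection S γ (j + 1)))))) := by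
  refine ⟨fun A C hC => ⟨exists_hyperbolicComponent_eq A,
    fun M _ => exists_lowerTriangular_mul_unitary (M⁻¹ * C), ?_⟩,
    fun A C hC => ⟨exists_real_hyperbolicComponent_eq A,
      fun M _ => exists_lowerTriangular_mul_unitary (M⁻¹ * C), ?_⟩, ?_⟩
  · obtain ⟨M₀, L₀, Q₀, h₀⟩ := exists_isHyperbolicFactorization A C
    refine ⟨Q₀ᴴ * toComplex (moduliMatrix A) * Q₀, fun B M L Q hB hM hH hL hQ hLQ => ?_⟩
    have h : IsHyperbolicFactorization A C M L Q := ⟨hM, hH, hL, hQ, hLQ⟩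
    exact ⟨h.tendsto_absRoot hB hC, h.conj_eq h₀ hC⟩
  · obtain ⟨M₀, hM₀, hH₀⟩ := exists_real_hyperbolicComponent_eq A
    obtain ⟨L₀, Q₀, hL₀, hQ₀, hLQ₀⟩ := exists_lowerTriangular_mul_unitary (M₀⁻¹ * C)
    have h₀ := isHyperbolicFactorization_toComplex hM₀ hH₀ hL₀ hQ₀ hLQ₀
    refine ⟨Q₀ᵀ * moduliMatrix (toComplex A) * Q₀, fun B M L Q hB hM hH hL hQ hLQ => ?_⟩
    have h := isHyperbolicFactorization_toComplex hM hH hL hQ hLQ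
    exact ⟨h.tendsto_absRoot_of_real hB hC, h.conj_eq_of_real h₀ hC⟩
  · rintro A S N rfl hSN hS hN s γ hγ hrange
    obtain ⟨M, L, Q, h, hE⟩ := hS.exists_spectralProjection_eq hN hSN
    obtain ⟨κ, hκ⟩ := exists_comp_eq_eigenvalueModuli hrange
    have hlayer {j : Fin s} {x : EuclideanSpace ℂ (Fin n)} :=
      mem_imageOf_nayakProjection_sdiff_iff h.mem_unitaryGroup hE hγ hκ (j := j) (x := x)
    have hcomm : Commute (S + N) S := (Commute.refl S).add_left hSN.symm
    rw [sum_smul_nayakProjection_sub hE hγ hκ]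
    refine ⟨⟨(star_left_conjugate_nonneg (toComplex_moduliMatrix_nonneg _) Q).posSemidef,
        by simpa using h.tendsto_absRoot isUnit_one isUnit_one⟩,
      fun j x hx => hlayer.trans (h.isLeast_iff_tendsto_norm_pow hγ hκ hx),
      fun j k => ⟨mapsTo_imageOf_nayakProjection (hcomm.pow_left k) j,
        fun hj x hx => hlayer.2 (h.isLeast_pow_apply hγ hκ hj.ne' k (hlayer.1 hx))⟩⟩
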